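/- Call an $n\times n$ random matrix $W_0$ complex Wishart with parameters $(n,s)$ if it has the law of $GG^*$, where $G$ is an $n\times s$ matrix with i.i.d. standard complex Gaussian entries ($\mathbb{E}|G_{ij}|^2=1$). For matrices $W_1,W_2$ on $\mathbb{C}^d\otimes\mathbb{C}^d$ let $$W=\frac1d\,\mathrm{Tr}_{\mathbb{C}^d\otimes\mathbb{C}^d}\big[(W_1\otimes W_2)\,P_d\big],\qquad P_d=\sum_{i,j=1}^d |i\rangle\langle j|\otimes|i\rangle\langle j|,$$ where $P_d$ acts on the first tensor factor of $W_1$ and the first tensor factor of $W_2$ (and as the identity on the other two), and the partial trace is over these two first factors, so that $W$ is a $d^2\times d^2$ matrix. Put $$Z=ds\left(\frac{W}{d^2s^2}-\frac{\mathbb 1}{d^2}\right).$$ **Corollary 3.5.** Let $c>0$ and let $s=s_d$ be a sequence of non-negative integers with $s_d/d\to c$ as $d\to\infty$. On a common probability space let, for each $d$, $W_1=W_1^{(d)}$ and $W_2=W_2^{(d)}$ be independent complex Wishart matrices with parameters $(d^2,s_d)$ (with an arbitrary joint law for different $d$). Then, almost surely, as $d\to\infty$, the empirical spectral distribution of $Z=Z^{(d)}$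 (the uniform probability measure on its $d^2$ eigenvalues, counted with multiplicity) converges, weakly and in all moments, to the centered Marchenko–Pastur distribution of parameter $c^2$ rescaled by $c$, that is, to the law of $(X-c^2)/c$, where $X$ has the Marchenko–Pastur (free Poisson) law of parameter $r=c^2$, $$\max(1-r,0)\,\delta_0+\frac{\sqrt{4r-(x-1-r)^2}}{2\pi x}\,\mathbf 1_{[(\sqrt r-1)^2,(\sqrt r+1)^2]}(x)\,dx .$$ -/

import Mathlib

open MeasureTheory ProbabilityTheory Filter Topology
open scoped Matrix Kronecker NNReal ENNReal BoundedContinuousFunction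

noncomputable section

namespace EntanglementSwapping

/-- The entrywise (product) measurable structure on matrices. -/
instance matrixMeasurableSpace {m n α : Type*} [MeasurableSpace α] :
    MeasurableSpace (Matrix m n α) :=
  inferInstanceAs (MeasurableSpace (m → n → α))

/-- The standard complex Gaussian distribution: the law of `x + i y`, where `x` and `y` are
independent real centered Gaussians of variance `1/2`, so that `E |x + i y|² = 1`. -/
def stdComplexGaussian : Measure ℂ :=
  ((gaussianReal 0 (1 / 2)).prod (gaussianReal 0 (1 / 2))).map
    (fun p : ℝ × ℝ => (p.1 : ℂ) + (p.2 : ℂ) * Complex.I)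

/-- The map sending the family of entries of an `n × s` matrix `G` to the matrix `G Gᴴ`. -/
def wishartMap {n : Type*} (s : ℕ) (g : n × Fin s → ℂ) : Matrix n n ℂ :=
  (Matrix.of fun i j => g (i, j)) * (Matrix.of fun i j => g (i, j))ᴴ

/-- `wishartMap` is measurable, so that its image measure below is the genuine one. -/
theorem measurable_wishartMap {n : Type*} (s : ℕ) :
    Measurable (wishartMap (n := n) s) := by
  refine measurable_pi_lambda _ fun i => measurable_pi_lambda _ fun j => ?_
  simp only [wishartMap, Matrix.mul_apply, Matrix.conjTranspose_apply, Matrix.of_apply]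
  refine Finset.measurable_sum _ fun k _ => ?_
  exact (measurable_pi_apply _).mul
    (Complex.continuous_conj.measurable.comp (measurable_pi_apply _))

/-- The complex Wishart distribution with parameters `(|n|, s)`: the law of `G Gᴴ`, where `G` is an
`n × s` random matrix with i.i.d. standard complex Gaussian entries. -/
def wishart (n : Type*) [Fintype n] (s : ℕ) : Measure (Matrix n n ℂ) :=
  (Measure.pi fun _ : n × Fin s => stdComplexGaussian).map (wishartMap s)

/-- The (unnormalized) Bell projection `∑ i j, |i⟩⟨j| ⊗ |i⟩⟨j|` on `ℂ^{d₁} ⊗ ℂ^{d₁}`. -/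
def bellProjection (d₁ : ℕ) : Matrix (Fin d₁ × Fin d₁) (Fin d₁ × Fin d₁) ℂ :=
  ∑ i : Fin d₁, ∑ j : Fin d₁, Matrix.single i j (1 : ℂ) ⊗ₖ Matrix.single i j (1 : ℂ)

/-- The partial trace over the first tensor factor, `∑ E_{ij} ⊗ T_{ij} ↦ ∑ T_{jj}`. -/
def partialTraceLeft {m n : Type*} [Fintype m] (T : Matrix (m × n) (m × n) ℂ) : Matrix n n ℂ :=
  Matrix.of fun k l => ∑ j : m, T (j, k) (j, l)

/-- The tensor product of two operators on `ℂ^{d₁} ⊗ ℂ^{d₂}`, with the tensor factors reordered as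
`(ℂ^{d₁} ⊗ ℂ^{d₁}) ⊗ (ℂ^{d₂} ⊗ ℂ^{d₂})`. -/
def reorderedTensor {d₁ d₂ : ℕ} (A B : Matrix (Fin d₁ × Fin d₂) (Fin d₁ × Fin d₂) ℂ) :
    Matrix ((Fin d₁ × Fin d₁) × (Fin d₂ × Fin d₂)) ((Fin d₁ × Fin d₁) × (Fin d₂ × Fin d₂)) ℂ :=
  Matrix.reindex (Equiv.prodProdProdComm _ _ _ _) (Equiv.prodProdProdComm _ _ _ _) (A ⊗ₖ B)

/-- The entanglement swapping `W = (1/d₁) Tr_{d₁} [(W₁ ⊗ W₂) P_{d₁}]`, where `P_{d₁}` acts on the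
two parties of dimension `d₁` (and as the identity on the other two). -/
def swap {d₁ d₂ : ℕ} (W₁ W₂ : Matrix (Fin d₁ × Fin d₂) (Fin d₁ × Fin d₂) ℂ) :
    Matrix (Fin d₂ × Fin d₂) (Fin d₂ × Fin d₂) ℂ :=
  (1 / (d₁ : ℂ)) • partialTraceLeft
    (reorderedTensor W₁ W₂ * (bellProjection d₁ ⊗ₖ (1 : Matrix (Fin d₂ × Fin d₂) _ ℂ)))

/-- The rescaled matrix `Z = d₂ s (W / (d₂² s²) - 1 / d₂²)`, where `W` is the entanglement
swapping of `W₁` and `W₂`. -/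
def rescaledSwap {d₁ d₂ : ℕ} (s : ℕ) (W₁ W₂ : Matrix (Fin d₁ × Fin d₂) (Fin d₁ × Fin d₂) ℂ) :
    Matrix (Fin d₂ × Fin d₂) (Fin d₂ × Fin d₂) ℂ :=
  ((d₂ : ℂ) * (s : ℂ)) •
    ((1 / ((d₂ : ℂ) ^ 2 * (s : ℂ) ^ 2)) • swap W₁ W₂ -
      (1 / (d₂ : ℂ) ^ 2) • (1 : Matrix (Fin d₂ × Fin d₂) (Fin d₂ × Fin d₂) ℂ))

open Classical in
/-- The empirical spectral distribution `(1/N) ∑ δ_{λᵢ}` of an `N × N` Hermitian matrix with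
eigenvalues `λᵢ` (counted with multiplicity); by convention `0` if the matrix is not Hermitian. -/
def empiricalSpectralDistribution {n : Type*} [Fintype n] [DecidableEq n]
    (A : Matrix n n ℂ) : Measure ℝ :=
  if h : A.IsHermitian then
    (Fintype.card n : ℝ≥0∞)⁻¹ • ∑ i : n, Measure.dirac (h.eigenvalues i)
  else 0

/-- The Marchenko-Pastur (free Poisson) distribution of parameter `r`, with density
`√(4 r - (x - 1 - r)²) / (2 π x)` on `[(√r - 1)², (√r + 1)²]`, and with an atom of mass
`max (1 - r) 0` at `0`. -/
def marchenkoPastur (r : ℝ) : Measure ℝ :=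
  ENNReal.ofReal (1 - r) • Measure.dirac 0 +
    (volume.restrict (Set.Icc ((√r - 1) ^ 2) ((√r + 1) ^ 2))).withDensity
      (fun x => ENNReal.ofReal (√(4 * r - (x - 1 - r) ^ 2) / (2 * Real.pi * x)))

/-- The centered Marchenko-Pastur distribution of parameter `c²`, rescaled by `c`: the law of
`(X - c²) / c`, where `X` has the Marchenko-Pastur distribution of parameter `c²` (whose mean
is `c²`). -/
def centeredRescaledMarchenkoPastur (c : ℝ) : Measure ℝ :=
  (marchenkoPastur (c ^ 2)).map (fun x => (x - c ^ 2) / c)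

end EntanglementSwapping

end

/-! The proof is the method of moments, made almost sure by a variance bound. Write # for the number
of cycles of a permutation, fixed points included, and U for the swap without its prefactor `1/d`
(`unnormalizedSwap`). Wick's formula turns the expectation of tr U^p into a sum over pairs (α, β) of
permutations of p points, with weight s^(#α + #β) d^(#(α⁻¹π) + #(β⁻¹π) + #(β⁻¹α)), where π is the
full cycle (`integral_cyclicTrace`).

Since s grows like cd, only the pairs of maximal total degree survive. The inequality #α + #(α⁻¹π) ≤
p + #π, used for α and for β, together with #(β⁻¹α) ≤ p, bounds the degree by 3p + 2#π. Equality
holds exactly when α = β lies on a geodesic from 1 to π (`degree_eq_iff`), so the normalized mean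
tends to the sum of c^(2#α) over these geodesics. Sorting the geodesics by the image of one point
cuts the cycle in two and yields a Catalan-type quadratic recursion (`geodesicSum_formPerm_mul`). On
the analytic side, the quadratic equation for the generating function yields a three-term linear
recursion (`mpMoment_linear_recursion`), which the integrals against the Marchenko–Pastur density
satisfy as well, by differentiating x^q times the 3/2 power of the polynomial under the root
(`mpIntegral_recursion`).

For almost sure convergence, the square of a trace is the same kind of cyclic product for two
disjoint copies of π. Subtracting the squared mean removes the pairs preserving both copies, and
every other pair loses at least two degrees (`degree_add_two_le`). The normalized variance is
therefore O(d⁻²), which is summable, so no joint law across dimensions is needed. Centering is a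
binomial expansion, and moment convergence to a compactly supported law gives weak convergence
(`tendsto_integral_of_tendsto_moments`). -/

namespace WishartMoments

/-! ### Cycle counts as dimensions of spaces of invariant functions -/

section Cycles

open Equiv

variable {T : Type*}

/-- The functions that are invariant under a permutation. -/
def invariants (σ : Perm T) : Submodule ℚ (T → ℚ) where
  carrier := {f | ∀ t, f (σ t) = f t}
  add_mem' hf hg t := by simp [hf t, hg t]
  zero_mem' t := rfl
  smul_mem' c f hf t := by simp [hf t]

theorem mem_invariants {σ : Perm T} {f : T → ℚ} :
    f ∈ invariants σ ↔ ∀ t, f (σ t) = f t := Iff.rfl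

/-- The number of cycles of a permutation, fixed points included. -/
noncomputable def numCycles (σ : Perm T) : ℕ := Module.finrank ℚ (invariants σ)

theorem invariants_inv (σ : Perm T) : invariants σ⁻¹ = invariants σ := by
  ext f
  constructor
  · intro h t
    simpa using (h (σ t)).symm
  · intro h t
    simpa using (h (σ⁻¹ t)).symm

theorem numCycles_inv (σ : Perm T) : numCycles σ⁻¹ = numCycles σ := by
  rw [numCycles, invariants_inv, numCycles]

theorem numCycles_mul_comm_le [Finite T] (σ τ : Perm T) :
    numCycles (σ * τ) ≤ numCycles (τ * σ) := by
  unfold numCycles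
  rw [← LinearEquiv.finrank_map_eq (LinearEquiv.funCongrLeft ℚ ℚ σ)]
  apply Submodule.finrank_mono
  rintro _ ⟨f, hf, rfl⟩ t
  exact hf (σ t)

theorem numCycles_mul_comm [Finite T] (σ τ : Perm T) : numCycles (σ * τ) = numCycles (τ * σ) :=
  le_antisymm (numCycles_mul_comm_le σ τ) (numCycles_mul_comm_le τ σ)

theorem invariants_inf_le (α β : Perm T) :
    invariants α ⊓ invariants β ≤ invariants (α * β) := by
  rintro f ⟨h1, h2⟩ t
  exact (h1 (β t)).trans (h2 t)

theorem numCycles_one [Fintype T] : numCycles (1 : Perm T) = Fintype.card T := by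
  have : invariants (1 : Perm T) = ⊤ := by
    ext f; simp [mem_invariants]
  rw [numCycles, this, finrank_top, Module.finrank_pi]

theorem numCycles_le [Fintype T] (σ : Perm T) : numCycles σ ≤ Fintype.card T := by
  rw [← Module.finrank_pi ℚ (ι := T)]
  exact Submodule.finrank_le _

/-- This is the triangle inequality for the Cayley distance. A function invariant under both factors
is invariant under the product, and the dimension formula for a sum of subspaces does the rest. -/
theorem numCycles_add_le [Fintype T] (α β : Perm T) :
    numCycles α + numCycles β ≤ Fintype.card T + numCycles (α * β) := by
  have h := Submodule.finrank_sup_add_finrank_inf_eq (invariants α) (invariants β)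
  have h1 := Submodule.finrank_mono (invariants_inf_le α β)
  have h2 : Module.finrank ℚ ↥(invariants α ⊔ invariants β) ≤ Fintype.card T := by
    rw [← Module.finrank_pi ℚ (ι := T)]
    exact Submodule.finrank_le _
  unfold numCycles
  omega

/-- In the equality case the intersection of the two invariant spaces has the full dimension of the
invariants of the product, hence equals them. -/
theorem invariants_mul_le_of_eq [Fintype T] {α β : Perm T}
    (h : numCycles α + numCycles β = Fintype.card T + numCycles (α * β)) :
    invariants (α * β) ≤ invariants α := by
  have h0 := Submodule.finrank_sup_add_finrank_inf_eq (invariants α) (invariants β)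
  have h2 : Module.finrank ℚ ↥(invariants α ⊔ invariants β) ≤ Fintype.card T := by
    rw [← Module.finrank_pi ℚ (ι := T)]
    exact Submodule.finrank_le _
  rw [← Submodule.eq_of_le_of_finrank_le (invariants_inf_le α β) (by unfold numCycles at h; omega)]
  exact inf_le_left

theorem numCycles_lt_card [Fintype T] {σ : Perm T} (h : σ ≠ 1) :
    numCycles σ < Fintype.card T := by
  classical
  rw [← Module.finrank_pi ℚ (ι := T)]
  apply Submodule.finrank_lt
  intro htop
  apply h
  ext t
  have hmem : Pi.single t (1 : ℚ) ∈ invariants σ := by rw [htop]; trivial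
  have := hmem t
  by_contra hne
  simp only [Perm.one_apply] at hne
  simp [hne] at this

theorem card_le_numCycles_swap [Fintype T] [DecidableEq T] (a b : T) :
    Fintype.card T ≤ numCycles (swap a b) + 1 := by
  let φ : (T → ℚ) →ₗ[ℚ] ℚ := LinearMap.proj (R := ℚ) (φ := fun _ : T => ℚ) a - LinearMap.proj (R := ℚ) (φ := fun _ : T => ℚ) b
  have hle : LinearMap.ker φ ≤ invariants (swap a b) := by
    intro f hf t
    have : f a = f b := by simpa [φ, sub_eq_zero] using hf
    by_cases h1 : t = a
    · subst h1; simp [this]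
    by_cases h2 : t = b
    · subst h2; simp [this]
    rw [swap_apply_of_ne_of_ne h1 h2]
  have h1 := Submodule.finrank_mono hle
  have h2 := LinearMap.finrank_range_add_finrank_ker φ
  have h3 := Submodule.finrank_le (LinearMap.range φ)
  rw [Module.finrank_pi] at h2
  simp only [Module.finrank_self] at h3
  unfold numCycles
  omega

theorem numCycles_le_swap_mul [Fintype T] [DecidableEq T] (a b : T) (σ : Perm T) :
    numCycles σ ≤ numCycles (swap a b * σ) + 1 := by
  have h := numCycles_add_le (swap a b) σ
  have := card_le_numCycles_swap a b
  omega

theorem numCycles_swap_mul_le [Fintype T] [DecidableEq T] (a b : T) (σ : Perm T) :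
    numCycles (swap a b * σ) ≤ numCycles σ + 1 := by
  simpa using numCycles_le_swap_mul a b (swap a b * σ)

/-- Splitting off a point from its cycle creates one more cycle. -/
theorem numCycles_swap_mul_self [Fintype T] [DecidableEq T] {a : T} {σ : Perm T} (h : σ a ≠ a) :
    numCycles (swap a (σ a) * σ) = numCycles σ + 1 := by
  refine le_antisymm (numCycles_swap_mul_le _ _ _) (Submodule.finrank_lt_finrank_of_lt ?_)
  refine lt_of_le_of_ne ?_ ?_
  · intro f hf t
    rw [Perm.mul_apply]
    by_cases h1 : σ t = a
    · rw [h1, swap_apply_left, hf, ← hf t, h1]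
    by_cases h2 : σ t = σ a
    · rw [h2, swap_apply_right, σ.injective h2]
    rw [swap_apply_of_ne_of_ne h1 h2, hf]
  -- The inclusion is strict: the indicator of `a` is invariant once `a` has become a fixed point,
  -- but not under `σ`.
  · intro heq
    have : Pi.single a (1 : ℚ) ∈ invariants σ := by
      rw [heq]
      intro t
      by_cases h1 : t = a
      · subst h1; simp
      rw [Pi.single_eq_of_ne h1, Pi.single_eq_of_ne]
      intro h2
      apply h1
      apply (swap a (σ a) * σ).injective
      rw [h2]; simp
    have := this a
    simp [h] at this

theorem eq_of_sameCycle {n : Type*} [Finite T] {σ : Perm T} {k : T → n}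
    (hk : ∀ t, k (σ t) = k t) {x y : T} (h : σ.SameCycle x y) : k x = k y := by
  obtain ⟨i, rfl⟩ := h.exists_nat_pow_eq
  clear h
  induction i with
  | zero => simp
  | succ i ih => rw [pow_succ', Perm.mul_apply, hk, ih]

/-- Functions invariant under a permutation are functions on its set of cycles. -/
def invariantsEquiv [Finite T] (σ : Perm T) (n : Type*) :
    {k : T → n // ∀ t, k (σ t) = k t} ≃ (Quotient (Perm.SameCycle.setoid σ) → n) where
  toFun k := Quotient.lift k.1 fun _ _ h => eq_of_sameCycle k.2 h
  invFun k := ⟨fun t => k (Quotient.mk _ t), fun t =>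
    congrArg k (Quotient.sound (Perm.sameCycle_apply_left.2 (Perm.SameCycle.refl _ _)))⟩
  left_inv k := rfl
  right_inv k := by
    ext q
    induction q using Quotient.inductionOn with
    | h t => rfl

/-- The dimension serves the inequalities; this identification with the number of orbits serves the
counting of colourings. -/
theorem numCycles_eq_card [Finite T] (σ : Perm T) :
    numCycles σ = Nat.card (Quotient (Perm.SameCycle.setoid σ)) := by
  have := Fintype.ofFinite (Quotient (Perm.SameCycle.setoid σ))
  let φ : (Quotient (Perm.SameCycle.setoid σ) → ℚ) →ₗ[ℚ] (T → ℚ) :=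
    LinearMap.funLeft ℚ ℚ (Quotient.mk _)
  have hφ : Function.Injective φ :=
    LinearMap.funLeft_injective_of_surjective _ _ _ Quotient.mk_surjective
  have hr : LinearMap.range φ = invariants σ := by
    ext f
    constructor
    · rintro ⟨k, rfl⟩
      exact ((invariantsEquiv σ ℚ).symm k).2
    · intro hf
      exact ⟨invariantsEquiv σ ℚ ⟨f, hf⟩, rfl⟩
  rw [numCycles, ← hr, LinearMap.finrank_range_of_inj hφ, Module.finrank_pi,
    Nat.card_eq_fintype_card]

theorem card_invariant_functions [Fintype T] [DecidableEq T] (σ : Perm T) (n : Type*) [Fintype n]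
    [DecidableEq n] :
    (Finset.univ.filter fun k : T → n => ∀ t, k (σ t) = k t).card =
      Fintype.card n ^ numCycles σ := by
  rw [← Fintype.card_subtype, ← Nat.card_eq_fintype_card, Nat.card_congr (invariantsEquiv σ n),
    numCycles_eq_card, Nat.card_fun, Nat.card_eq_fintype_card (α := n)]

theorem numCycles_sumCongr {T' : Type*} [Finite T] [Finite T'] (σ : Perm T) (τ : Perm T') :
    numCycles (Perm.sumCongr σ τ) = numCycles σ + numCycles τ := by
  have h := Fintype.ofFinite T
  have h' := Fintype.ofFinite T'
  let e : invariants (Perm.sumCongr σ τ) ≃ₗ[ℚ] invariants σ × invariants τ :=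
    { toFun := fun k => (⟨fun t => k.1 (Sum.inl t), fun t => k.2 (Sum.inl t)⟩,
        ⟨fun t => k.1 (Sum.inr t), fun t => k.2 (Sum.inr t)⟩)
      invFun := fun fg => ⟨Sum.elim fg.1.1 fg.2.1, by
        rintro (t | t)
        · exact fg.1.2 t
        · exact fg.2.2 t⟩
      map_add' := fun _ _ => rfl
      map_smul' := fun _ _ => rfl
      left_inv := fun k => by ext (t | t) <;> rfl
      right_inv := fun fg => rfl }
  unfold numCycles
  rw [e.finrank_eq, Module.finrank_prod]

end Cycles

/-- The moments of the Marchenko-Pastur distribution of parameter `r`, defined by the quadratic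
recursion of their generating function. -/
noncomputable def mpMoment (r : ℝ) : ℕ → ℝ
  | 0 => 1
  | q + 1 => r * mpMoment r q + ∑ i : Fin q, mpMoment r i * mpMoment r (q - i)

theorem mpMoment_zero (r : ℝ) : mpMoment r 0 = 1 := by rw [mpMoment]

theorem mpMoment_succ (r : ℝ) (q : ℕ) :
    mpMoment r (q + 1) =
      r * mpMoment r q + ∑ i : Fin q, mpMoment r i * mpMoment r (q - i) := by
  rw [mpMoment]

/-! ### Cutting and shortening cycles given by lists -/

section FormPerm

open Equiv

variable {T : Type*} [DecidableEq T]

/-- A transposition of two points of a cycle cuts it into two cycles; the induction moves the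
transposition past the entries of `u` one at a time. -/
theorem formPerm_split (a j : T) (u v : List T) (h : (a :: (u ++ j :: v)).Nodup) :
    List.formPerm (a :: (u ++ j :: v)) =
      swap a j * (List.formPerm (a :: u) * List.formPerm (j :: v)) := by
  induction u generalizing a with
  | nil => simp
  | cons b u ih =>
    have hb := (List.nodup_cons.1 h).2
    rw [List.cons_append, List.formPerm_cons_cons]
    rw [List.cons_append] at hb
    rw [ih b hb, List.formPerm_cons_cons]
    have hab : a ≠ b := by rintro rfl; simp at h
    have haj : a ≠ j := by rintro rfl; simp at h
    have hbj : b ≠ j := by rintro rfl; simp at h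
    have : swap a b * swap b j = swap a j * swap a b := by
      rw [mul_swap_eq_swap_mul, swap_apply_right, swap_apply_of_ne_of_ne haj.symm hbj.symm]
    simp only [← mul_assoc, this]

theorem formPerm_cons_mul_apply {a b : T} {l : List T} {ρ : Perm T}
    (hl : (a :: b :: l).Nodup) (hρ : ρ a = a) : (List.formPerm (a :: b :: l) * ρ) a = b := by
  rw [Perm.mul_apply, hρ, List.formPerm_apply_head _ _ _ hl]

theorem swap_mul_formPerm_mul (a : T) (l : List T) (ρ : Perm T)
    (hl : (a :: l).Nodup) (hρ : ρ a = a) :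
    swap a ((List.formPerm (a :: l) * ρ) a) * (List.formPerm (a :: l) * ρ) =
      List.formPerm l * ρ := by
  cases l with
  | nil =>
    rw [List.formPerm_singleton, one_mul, hρ, swap_self]; rfl
  | cons b l =>
    rw [formPerm_cons_mul_apply hl hρ, List.formPerm_cons_cons, ← mul_assoc, ← mul_assoc,
      swap_mul_self, one_mul]

theorem formPerm_mul_apply_fixed {t : T} {l : List T} {ρ : Perm T} (ht : t ∉ l) (hρ : ρ t = t) :
    (List.formPerm l * ρ) t = t := by
  rw [Perm.mul_apply, hρ, List.formPerm_apply_of_notMem ht]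

end FormPerm

/-! ### Geodesics in the symmetric group and their generating function -/

section Geodesics

open Equiv

variable {T : Type*} [Fintype T]

/-- `α` lies on a geodesic from `1` to `π` in the Cayley graph generated by the transpositions. -/
def IsGeodesic (α π : Perm T) : Prop :=
  numCycles α + numCycles (α⁻¹ * π) = Fintype.card T + numCycles π

/-- In other words, each cycle of `α` lies inside a cycle of `π`. Testing this on indicator
functions locates the values of `α`. -/
theorem IsGeodesic.invariants_le {α π : Perm T} (h : IsGeodesic α π) :
    invariants π ≤ invariants α := by
  have := invariants_mul_le_of_eq (α := α) (β := α⁻¹ * π) (by rw [mul_inv_cancel_left]; exact h)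
  rwa [mul_inv_cancel_left] at this

theorem numCycles_add_inv_mul_le (α π : Perm T) :
    numCycles α + numCycles (α⁻¹ * π) ≤ Fintype.card T + numCycles π := by
  simpa using numCycles_add_le α (α⁻¹ * π)

variable [DecidableEq T]

/-- Detaching `a` from its cycle in `ρ` also detaches it in `α⁻¹ * ρ`, because `α` fixes `a`. Both
sides of the geodesic equation then gain one cycle. -/
theorem isGeodesic_iff_of_fixed {a : T} {α ρ : Perm T} (h : α a = a) :
    IsGeodesic α (swap a (ρ a) * ρ) ↔ IsGeodesic α ρ := by
  by_cases hρ : ρ a = a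
  · rw [hρ, swap_self]; rfl
  have h1 := numCycles_swap_mul_self hρ
  have hα : α⁻¹ a = a := by rw [Perm.inv_eq_iff_eq, h]
  have h2 : (α⁻¹ * ρ) a ≠ a := by
    intro h2
    apply hρ
    rw [Perm.mul_apply, Perm.inv_eq_iff_eq, h] at h2
    exact h2
  have h3 := numCycles_swap_mul_self h2
  have h4 : α⁻¹ * (swap a (ρ a) * ρ) = swap a ((α⁻¹ * ρ) a) * (α⁻¹ * ρ) := by
    rw [← mul_assoc, mul_swap_eq_swap_mul, hα, mul_assoc]; rfl
  unfold IsGeodesic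
  rw [h4, h1, h3]
  omega

theorem IsGeodesic.apply_eq_self {a : T} {α ρ : Perm T} (h : IsGeodesic α ρ) (hρ : ρ a = a) :
    α a = a := by
  have h1 : Pi.single a (1 : ℚ) ∈ invariants ρ := by
    intro t
    by_cases ht : t = a
    · subst ht; rw [hρ]
    · rw [Pi.single_eq_of_ne ht, Pi.single_eq_of_ne]
      intro h2
      exact ht (ρ.injective (h2.trans hρ.symm))
  have h2 := h.invariants_le h1 a
  by_contra hne
  simp [hne] at h2

theorem IsGeodesic.apply_mem {a : T} {s : Finset T} {α ρ : Perm T} (h : IsGeodesic α ρ)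
    (hs : ∀ t, ρ t ∈ s ↔ t ∈ s) (ha : a ∈ s) : α a ∈ s := by
  have h1 : (fun t => if t ∈ s then (1 : ℚ) else 0) ∈ invariants ρ := by
    intro t
    simp only [hs]
  have h2 := h.invariants_le h1 a
  by_contra hne
  simp [hne, ha] at h2

theorem isGeodesic_swap_mul_iff {a j : T} (haj : a ≠ j) {α π : Perm T} (hα : α a = a)
    (hπ : numCycles (swap a j * π) = numCycles π + 1) :
    IsGeodesic (swap a j * α) π ↔ IsGeodesic α (swap a j * π) := by
  have h1 := numCycles_swap_mul_self (a := a) (σ := swap a j * α) (by simp [hα, haj.symm])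
  simp only [Perm.mul_apply, hα, swap_apply_left, swap_mul_self_mul] at h1
  unfold IsGeodesic
  rw [mul_inv_rev, swap_inv, mul_assoc, hπ, h1]
  omega

open Classical in
/-- The generating function of the number of cycles over the geodesics to `π`. -/
noncomputable def geodesicSum (r : ℝ) (π : Perm T) : ℝ :=
  ∑ α ∈ Finset.univ.filter (fun α : Perm T => IsGeodesic α π), r ^ numCycles α

/-- Removing the head of the list detaches one point and creates exactly one cycle; `ρ` is carried
along for the other cycles. -/
theorem numCycles_formPerm_mul (a : T) (l : List T) (ρ : Perm T)
    (hl : (a :: l).Nodup) (hρ : ∀ t ∈ a :: l, ρ t = t) :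
    numCycles (List.formPerm (a :: l) * ρ) + l.length = numCycles ρ := by
  induction l generalizing a with
  | nil => simp
  | cons b l ih =>
    have h1 := swap_mul_formPerm_mul a (b :: l) ρ hl (hρ a (by simp))
    have h2 := numCycles_swap_mul_self (a := a) (σ := List.formPerm (a :: b :: l) * ρ) (by
      rw [formPerm_cons_mul_apply hl (hρ a (by simp))]
      rintro rfl; simp at hl)
    rw [h1] at h2
    have h3 := ih b (List.nodup_cons.1 hl).2 (fun t ht => hρ t (List.mem_cons_of_mem _ ht))
    rw [List.length_cons]
    omega

/-- The bijection is `α ↦ swap a j * α`: it makes `a` a fixed point and turns a geodesic to the long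
cycle into one to the two pieces. The factor `r` pays for the cycle gained by `α`. -/
theorem sum_geodesic_of_split (r : ℝ) (a j : T) (u v : List T) (ρ : Perm T)
    (hl : (a :: (u ++ j :: v)).Nodup) (hρ : ∀ t ∈ a :: (u ++ j :: v), ρ t = t) :
    (open Classical in
      r * ∑ α ∈ Finset.univ.filter (fun α : Perm T =>
        IsGeodesic α (List.formPerm (a :: (u ++ j :: v)) * ρ) ∧ α a = j), r ^ numCycles α) =
      geodesicSum r (List.formPerm u * (List.formPerm (j :: v) * ρ)) := by
  classical
  have haj : a ≠ j := by rintro rfl; simp at hl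
  have hau : (a :: u).Nodup := by
    refine hl.sublist ?_
    simp
  have hjv : (j :: v).Nodup := by
    refine hl.sublist ?_
    exact (List.sublist_append_right _ _).trans (List.sublist_cons_self _ _)
  have hajv : a ∉ j :: v := by
    intro h
    exact (List.nodup_cons.1 hl).1 (List.mem_append_right _ h)
  have hdisj : ∀ t ∈ a :: u, t ∉ j :: v := by
    intro t ht ht'
    rcases List.mem_cons.1 ht with rfl | ht
    · exact hajv ht'
    · exact (List.nodup_append.1 (List.nodup_cons.1 hl).2).2.2 t ht t ht' rfl
  set π := List.formPerm (a :: (u ++ j :: v)) * ρ with hπ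
  set ρ' := List.formPerm (j :: v) * ρ with hρ'
  have hρ'fix : ∀ t ∈ a :: u, ρ' t = t := fun t ht =>
    formPerm_mul_apply_fixed (hdisj t ht) (hρ t (by
      rcases List.mem_cons.1 ht with rfl | ht
      · simp
      · simp [ht]))
  have hsplit : swap a j * π = List.formPerm (a :: u) * ρ' := by
    rw [hπ, formPerm_split a j u v hl, hρ']
    simp only [mul_assoc, swap_mul_self_mul]
  have hcyc : numCycles (swap a j * π) = numCycles π + 1 := by
    have h1 := numCycles_formPerm_mul a (u ++ j :: v) ρ hl hρ
    have h2 := numCycles_formPerm_mul a u ρ' hau hρ'fix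
    have h3 := numCycles_formPerm_mul j v ρ hjv (fun t ht => hρ t
      (List.mem_cons_of_mem _ (List.mem_append_right _ ht)))
    rw [← hρ'] at h3
    rw [hsplit]
    rw [← hπ] at h1
    simp only [List.length_append, List.length_cons] at h1
    omega
  have hrem := swap_mul_formPerm_mul a u ρ' hau (hρ'fix a (by simp))
  have hfix : (List.formPerm u * ρ') a = a :=
    formPerm_mul_apply_fixed (List.nodup_cons.1 hau).1 (hρ'fix a (by simp))
  -- Since the modified permutation fixes `a`, the point `a` may also be dropped from the piece `a
  -- :: u`.
  have key : ∀ α : Perm T, IsGeodesic α (List.formPerm u * ρ') ↔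
      IsGeodesic (swap a j * α) π ∧ α a = a := by
    intro α
    constructor
    · intro h
      have hα := h.apply_eq_self hfix
      refine ⟨?_, hα⟩
      rw [isGeodesic_swap_mul_iff haj hα hcyc, hsplit, ← isGeodesic_iff_of_fixed hα, hrem]
      exact h
    · rintro ⟨h, hα⟩
      rwa [isGeodesic_swap_mul_iff haj hα hcyc, hsplit, ← isGeodesic_iff_of_fixed hα, hrem] at h
  rw [geodesicSum, Finset.mul_sum]
  refine Finset.sum_bij' (fun α _ => swap a j * α) (fun α _ => swap a j * α) ?_ ?_ ?_ ?_ ?_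
  · intro α hα
    simp only [Finset.mem_filter, Finset.mem_univ, true_and] at hα ⊢
    rw [key, swap_mul_self_mul]
    exact ⟨hα.1, by simp [hα.2]⟩
  · intro α hα
    simp only [Finset.mem_filter, Finset.mem_univ, true_and] at hα ⊢
    rw [key] at hα
    exact ⟨hα.1, by simp [hα.2]⟩
  · intro α _; simp
  · intro α _; simp
  · intro α hα
    simp only [Finset.mem_filter, Finset.mem_univ, true_and] at hα
    have h1 := numCycles_swap_mul_self (a := a) (σ := α) (by rw [hα.2]; exact haj.symm)
    rw [hα.2] at h1
    rw [h1, pow_succ']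

/-- Geodesics are sorted by the image of `a`, which stays in the cycle. If `a` is fixed it is
dropped; if it goes to the entry at position `i`, the list breaks at that position. -/
theorem mul_geodesicSum_formPerm_cons (r : ℝ) (a : T) (l : List T) (ρ : Perm T)
    (hl : (a :: l).Nodup) (hρ : ∀ t ∈ a :: l, ρ t = t) :
    r * geodesicSum r (List.formPerm (a :: l) * ρ) =
      r * geodesicSum r (List.formPerm l * ρ) +
        ∑ i : Fin l.length, geodesicSum r
          (List.formPerm (l.take i) * (List.formPerm (l.drop i) * ρ)) := by
  classical
  set π := List.formPerm (a :: l) * ρ with hπ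
  have hmem : ∀ t, π t ∈ (a :: l).toFinset ↔ t ∈ (a :: l).toFinset := by
    intro t
    rw [List.mem_toFinset, List.mem_toFinset, hπ, Perm.mul_apply, List.formPerm_mem_iff_mem]
    constructor
    · intro h
      rwa [← ρ.injective (hρ _ h)]
    · intro h
      rwa [hρ t h]
  have h1 : geodesicSum r π = ∑ j ∈ (a :: l).toFinset,
      ∑ α ∈ Finset.univ.filter (fun α : Perm T => IsGeodesic α π ∧ α a = j), r ^ numCycles α := by
    rw [geodesicSum, ← Finset.sum_fiberwise_of_maps_to (g := fun α : Perm T => α a)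
      (t := (a :: l).toFinset)]
    · simp only [Finset.filter_filter]
    · intro α hα
      simp only [Finset.mem_filter, Finset.mem_univ, true_and] at hα
      exact hα.apply_mem hmem (by simp)
  have hal : a ∉ l.toFinset := by simpa using (List.nodup_cons.1 hl).1
  have hfix : (List.formPerm l * ρ) a = a :=
    formPerm_mul_apply_fixed (List.nodup_cons.1 hl).1 (hρ a (by simp))
  have hrem := swap_mul_formPerm_mul a l ρ hl (hρ a (by simp))
  rw [h1, List.toFinset_cons, Finset.sum_insert hal, mul_add]
  congr 1
  · rw [geodesicSum]
    congr 2
    ext α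
    simp only [Finset.mem_filter, Finset.mem_univ, true_and]
    constructor
    · rintro ⟨h, hα⟩
      rwa [← isGeodesic_iff_of_fixed hα, hrem] at h
    · intro h
      have hα := h.apply_eq_self hfix
      refine ⟨?_, hα⟩
      rwa [← isGeodesic_iff_of_fixed hα, hrem]
  · rw [List.sum_toFinset _ (List.nodup_cons.1 hl).2, ← Fin.sum_univ_fun_getElem, Finset.mul_sum]
    refine Finset.sum_congr rfl fun i _ => ?_
    have hi : l = l.take i ++ l[i] :: l.drop (i + 1) := by simp
    have hd : l.drop i = l[i] :: l.drop (i + 1) := by simp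
    rw [hd, ← sum_geodesic_of_split r a]
    · rw [← hi]; rfl
    · rwa [← hi]
    · rwa [← hi]

/-- The power of `r` compensates for working on a fixed set `T`: entries no longer in any cycle
remain as fixed points of every geodesic, each contributing a factor `r`. Allowing a general `ρ`
lets the induction treat the two pieces one after the other. -/
theorem geodesicSum_formPerm_mul (r : ℝ) (n : ℕ) : ∀ (l : List T) (ρ : Perm T), l.length = n →
    l.Nodup → (∀ t ∈ l, ρ t = t) →
    r ^ l.length * geodesicSum r (List.formPerm l * ρ) = mpMoment r l.length * geodesicSum r ρ := by
  induction n using Nat.strong_induction_on with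
  | _ n ih =>
  intro l ρ hn hl hρ
  cases l with
  | nil => simp [mpMoment_zero]
  | cons a l =>
    have hl' := (List.nodup_cons.1 hl).2
    simp only [List.length_cons] at hn
    rw [List.length_cons, pow_succ, mul_assoc, mul_geodesicSum_formPerm_cons r a l ρ hl hρ,
      mpMoment_succ, mul_add, add_mul, Finset.mul_sum, Finset.sum_mul]
    congr 1
    · rw [mul_left_comm, ih l.length (by omega) l ρ rfl hl' (fun t ht => hρ t (by simp [ht])),
        mul_assoc]
    · refine Finset.sum_congr rfl fun i _ => ?_
      have hdisj := List.disjoint_take_drop hl' (le_refl (i : ℕ))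
      have ht := ih (l.take i).length (by simp; omega) (l.take i) (List.formPerm (l.drop i) * ρ) rfl
        (hl'.sublist (List.take_sublist _ _)) (fun t ht => formPerm_mul_apply_fixed
          (fun h => hdisj ht h) (hρ t (List.mem_cons_of_mem _ (List.mem_of_mem_take ht))))
      have hd := ih (l.drop i).length (by simp; omega) (l.drop i) ρ rfl
        (hl'.sublist (List.drop_sublist _ _))
        (fun t ht => hρ t (List.mem_cons_of_mem _ (List.mem_of_mem_drop ht)))
      have hi : min (i : ℕ) l.length = i := min_eq_left i.2.le
      rw [List.length_take, hi] at ht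
      rw [List.length_drop] at hd
      have hsum : r ^ l.length = r ^ (l.length - i) * r ^ (i : ℕ) := by
        rw [← pow_add]
        congr 1
        omega
      rw [mul_assoc, ← hd, mul_left_comm, ← ht]
      rw [hsum]
      ring

theorem geodesicSum_one (r : ℝ) : geodesicSum r (1 : Perm T) = r ^ Fintype.card T := by
  classical
  have : Finset.univ.filter (fun α : Perm T => IsGeodesic α 1) = {1} := by
    ext α
    simp only [Finset.mem_filter, Finset.mem_univ, true_and, Finset.mem_singleton]
    constructor
    · intro h
      ext a
      exact h.apply_eq_self rfl
    · rintro rfl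
      simp [IsGeodesic, numCycles_one]
  rw [geodesicSum, this, Finset.sum_singleton, numCycles_one]

theorem geodesicSum_formPerm {r : ℝ} (hr : r ≠ 0) (l : List T) (hl : l.Nodup)
    (hall : l.length = Fintype.card T) :
    geodesicSum r (List.formPerm l) = mpMoment r (Fintype.card T) := by
  have h := geodesicSum_formPerm_mul r l.length l 1 rfl hl (fun _ _ => rfl)
  rw [mul_one, geodesicSum_one, hall, mul_comm (mpMoment _ _)] at h
  exact mul_left_cancel₀ (pow_ne_zero _ hr) h

theorem formPerm_finRange (n : ℕ) : List.formPerm (List.finRange (n + 1)) = finRotate (n + 1) := by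
  ext i
  have h := List.formPerm_apply_getElem (List.finRange (n + 1)) (List.nodup_finRange _) i (by simp; omega)
  simp only [List.getElem_finRange, List.length_finRange, Fin.cast_mk, Fin.eta] at h
  rw [h, finRotate_apply, Fin.val_add]
  simp

theorem geodesicSum_finRotate {r : ℝ} (hr : r ≠ 0) (n : ℕ) :
    geodesicSum r (finRotate (n + 1)) = mpMoment r (n + 1) := by
  rw [← formPerm_finRange, geodesicSum_formPerm hr _ (List.nodup_finRange _) (by simp),
    Fintype.card_fin]

end Geodesics

/-! ### From the quadratic to a three-term linear recursion -/

section Recursion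

open PowerSeries

theorem mpMoment_genFun (r : ℝ) :
    (PowerSeries.mk (mpMoment r)) = 1 + X * (PowerSeries.mk (mpMoment r) * PowerSeries.mk (mpMoment r))
      + C (r - 1) * (X * PowerSeries.mk (mpMoment r)) := by
  ext n
  cases n with
  | zero => simp [mpMoment_zero]
  | succ q =>
    simp only [map_add, coeff_succ_X_mul, coeff_C_mul, coeff_mk]
    rw [coeff_mul]
    simp only [coeff_mk]
    rw [Finset.Nat.sum_antidiagonal_eq_sum_range_succ (fun i j => mpMoment r i * mpMoment r j),
      Finset.sum_range_succ, Finset.sum_range, mpMoment_succ]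
    simp [coeff_one, mpMoment_zero]
    ring

theorem mpMoment_one (r : ℝ) : mpMoment r 1 = r := by
  simp [mpMoment_succ, mpMoment_zero]

/-- Completing the square in the quadratic equation gives u² = D with D the discriminant, a
polynomial. Differentiating and multiplying by u gives 2Du' = D'u, whose coefficients are the
recursion. -/
theorem mpMoment_linear_recursion (r : ℝ) (q : ℕ) :
    ((q : ℝ) + 3) * mpMoment r (q + 2) =
      (2 * q + 3) * (1 + r) * mpMoment r (q + 1) - q * (1 - r) ^ 2 * mpMoment r q := by
  set F := PowerSeries.mk (mpMoment r) with hF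
  set u : ℝ⟦X⟧ := C 2 * (X * F) + C (r - 1) * X - 1 with hu
  have hsq : u * u = 1 - C (2 * (r + 1)) * X + C ((r - 1) ^ 2) * (X * X) := by
    have h := mpMoment_genFun r
    rw [← hF] at h
    have h1 : X * (F * F) = F - 1 - C (r - 1) * (X * F) := by linear_combination -h
    have h2 : (C (2 : ℝ) : ℝ⟦X⟧) = 2 := map_ofNat C 2
    have h3 : (C (2 * (r + 1)) : ℝ⟦X⟧) = 2 * (C r + 1) := by
      rw [map_mul, map_add, map_one, h2]
    rw [hu, h3, h2]
    simp only [map_sub, map_one, map_pow] at h1 ⊢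
    linear_combination (4 * X) * h1
  have hder := congrArg (PowerSeries.derivative ℝ) hsq
  have h4 : (C 2 : ℝ⟦X⟧) * (1 - C (2 * (r + 1)) * X + C ((r - 1) ^ 2) * (X * X)) *
      PowerSeries.derivative ℝ u = (C 2 * C ((r - 1) ^ 2) * X - C (2 * (r + 1))) * u := by
    simp only [Derivation.leibniz, map_add, map_sub, smul_eq_mul, derivative_C, derivative_X,
      Derivation.map_one_eq_zero] at hder
    have h2 : (C (2 : ℝ) : ℝ⟦X⟧) = 2 := map_ofNat C 2
    rw [← hsq, h2]
    linear_combination u * hder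
  have hc := congrArg (PowerSeries.coeff (q + 2)) h4
  have hu1 : ∀ k, coeff (k + 2) u = 2 * mpMoment r (k + 1) := by
    intro k
    rw [hu]
    simp [coeff_succ_X_mul, coeff_one, hF]
  have e : (C 2 : ℝ⟦X⟧) * (1 - C (2 * (r + 1)) * X + C ((r - 1) ^ 2) * (X * X)) *
      PowerSeries.derivative ℝ u = C 2 * PowerSeries.derivative ℝ u
        - C (4 * (r + 1)) * (X * PowerSeries.derivative ℝ u)
        + C (2 * (r - 1) ^ 2) * (X * (X * PowerSeries.derivative ℝ u)) := by
    have h2 : (C (2 : ℝ) : ℝ⟦X⟧) = 2 := map_ofNat C 2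
    have h3 : (C (4 : ℝ) : ℝ⟦X⟧) = 4 := map_ofNat C 4
    simp only [map_mul, h2, h3]
    ring
  have e' : (C 2 * C ((r - 1) ^ 2) * X - C (2 * (r + 1))) * u =
      C (2 * (r - 1) ^ 2) * (X * u) - C (2 * (r + 1)) * u := by
    simp only [map_mul]
    ring
  rw [e, e'] at hc
  simp only [map_add, map_sub, coeff_C_mul, coeff_succ_X_mul, coeff_derivative, hu1] at hc
  -- For `q = 0` the coefficient of `u` in degree one is not covered by `hu1`, but it occurs equally
  -- on both sides and cancels.
  cases q with
  | zero =>
    have h6 : coeff (0 + 1) u = coeff 1 u := rfl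
    rw [h6] at hc
    push_cast at hc ⊢
    linear_combination hc / 4
  | succ q =>
    simp only [hu1] at hc
    push_cast at hc ⊢
    linear_combination hc / 4

end Recursion

/-! ### Integrals against the Marchenko–Pastur density -/

section Integrals

/-- The polynomial whose square root is the numerator of the density of the Marchenko-Pastur
distribution of parameter `c ^ 2`. -/
def mpPoly (c x : ℝ) : ℝ := 4 * c ^ 2 - (x - 1 - c ^ 2) ^ 2

theorem continuous_mpPoly (c : ℝ) : Continuous (mpPoly c) := by
  unfold mpPoly; fun_prop

theorem mpPoly_eq (c x : ℝ) : mpPoly c x = (x - (c - 1) ^ 2) * ((c + 1) ^ 2 - x) := by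
  unfold mpPoly; ring

theorem mpPoly_pos {c x : ℝ} (h : x ∈ Set.Ioo ((c - 1) ^ 2) ((c + 1) ^ 2)) : 0 < mpPoly c x := by
  rw [mpPoly_eq]
  exact mul_pos (sub_pos.2 h.1) (sub_pos.2 h.2)

theorem mpPoly_left (c : ℝ) : mpPoly c ((c - 1) ^ 2) = 0 := by rw [mpPoly_eq]; ring

theorem mpPoly_right (c : ℝ) : mpPoly c ((c + 1) ^ 2) = 0 := by rw [mpPoly_eq]; ring

theorem edge_le {c : ℝ} (hc : 0 < c) : (c - 1) ^ 2 ≤ (c + 1) ^ 2 := by nlinarith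

theorem hasDerivAt_sqrt_mpPoly {c x : ℝ} (h : x ∈ Set.Ioo ((c - 1) ^ 2) ((c + 1) ^ 2)) :
    HasDerivAt (fun y => √(mpPoly c y)) (-(x - 1 - c ^ 2) / √(mpPoly c x)) x := by
  have h1 : HasDerivAt (mpPoly c) (-(2 * (x - 1 - c ^ 2))) x := by
    unfold mpPoly
    have := (((hasDerivAt_id x).sub_const 1).sub_const (c ^ 2)).pow 2 |>.const_sub (4 * c ^ 2)
    refine this.congr_deriv ?_
    simp
  have h2 := h1.sqrt (mpPoly_pos h).ne'
  refine h2.congr_deriv ?_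
  have := Real.sqrt_pos.2 (mpPoly_pos h)
  field_simp

/-- The unnormalized moments `∫ x ^ q √(4 c² - (x - 1 - c²)²) dx`. -/
noncomputable def mpIntegral (c : ℝ) (q : ℕ) : ℝ :=
  ∫ x in ((c - 1) ^ 2)..((c + 1) ^ 2), x ^ q * √(mpPoly c x)

theorem mpIntegral_zero {c : ℝ} (hc : 0 < c) : mpIntegral c 0 = 2 * Real.pi * c ^ 2 := by
  -- The substitution x = 2cy + 1 + c² reduces the integral to the area of a half disc.
  have h := intervalIntegral.integral_comp_mul_add (a := -1) (b := 1)
    (fun x => √(mpPoly c x)) (c := 2 * c) (by positivity) (1 + c ^ 2)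
  have e1 : (2 * c) * (-1) + (1 + c ^ 2) = (c - 1) ^ 2 := by ring
  have e2 : (2 * c) * 1 + (1 + c ^ 2) = (c + 1) ^ 2 := by ring
  have e3 : ∀ y : ℝ, √(mpPoly c ((2 * c) * y + (1 + c ^ 2))) = 2 * c * √(1 - y ^ 2) := by
    intro y
    have : mpPoly c ((2 * c) * y + (1 + c ^ 2)) = (2 * c) ^ 2 * (1 - y ^ 2) := by
      unfold mpPoly; ring
    rw [this, Real.sqrt_mul (by positivity), Real.sqrt_sq (by positivity)]
  simp only [e1, e2, e3, intervalIntegral.integral_const_mul, integral_sqrt_one_sub_sq,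
    smul_eq_mul] at h
  simp only [mpIntegral, pow_zero, one_mul]
  field_simp at h
  linarith

theorem mpIntegral_recursion {c : ℝ} (hc : 0 < c) (q : ℕ) :
    ((q : ℝ) + 3) * mpIntegral c (q + 1) =
      (2 * q + 3) * (1 + c ^ 2) * mpIntegral c q
        - q * (1 - c ^ 2) ^ 2 * mpIntegral c (q - 1) := by
  have hcont := continuous_mpPoly c
  -- The function x^q P^(3/2) vanishes at both edges, and its derivative is √P times a polynomial.
  have h := intervalIntegral.integral_eq_sub_of_hasDerivAt_of_le (edge_le hc)
    (f := fun x => x ^ q * (mpPoly c x * √(mpPoly c x)))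
    (f' := fun x => -((q : ℝ) + 3) * (x ^ (q + 1) * √(mpPoly c x))
      + (2 * q + 3) * (1 + c ^ 2) * (x ^ q * √(mpPoly c x))
      - q * (1 - c ^ 2) ^ 2 * (x ^ (q - 1) * √(mpPoly c x))) (by fun_prop) ?_ ?_
  · rw [intervalIntegral.integral_sub, intervalIntegral.integral_add] at h
    · simp only [intervalIntegral.integral_const_mul, mpPoly_left, mpPoly_right] at h
      unfold mpIntegral
      simp only [zero_mul, mul_zero, sub_zero] at h
      linarith
    all_goals
      apply Continuous.intervalIntegrable
      fun_prop
  · intro x hx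
    have h1 : HasDerivAt (mpPoly c) (-(2 * (x - 1 - c ^ 2))) x := by
      unfold mpPoly
      have := (((hasDerivAt_id x).sub_const 1).sub_const (c ^ 2)).pow 2 |>.const_sub (4 * c ^ 2)
      refine this.congr_deriv ?_
      simp
    have h2 := (hasDerivAt_pow q x).mul (h1.mul (hasDerivAt_sqrt_mpPoly hx))
    refine h2.congr_deriv ?_
    have hpos := mpPoly_pos hx
    set S := √(mpPoly c x) with hS
    have hS0 : 0 < S := Real.sqrt_pos.2 hpos
    have hSS : mpPoly c x = S * S := (Real.mul_self_sqrt hpos.le).symm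
    have hP : mpPoly c x = -x * x + 2 * (1 + c ^ 2) * x - (1 - c ^ 2) ^ 2 := by
      unfold mpPoly; ring
    have h3 : mpPoly c x * (-(x - 1 - c ^ 2) / S) = S * (-(x - 1 - c ^ 2)) := by
      rw [hSS]; field_simp
    rw [Pi.mul_apply, h3]
    cases q with
    | zero =>
      simp
      ring
    | succ q =>
      rw [← hS, hP]
      simp only [Nat.add_sub_cancel]
      push_cast
      ring
  · apply Continuous.intervalIntegrable
    fun_prop

/-- The index shifts by one because the density carries a factor 1/x. -/
theorem mpIntegral_eq {c : ℝ} (hc : 0 < c) (q : ℕ) :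
    mpIntegral c q = 2 * Real.pi * mpMoment (c ^ 2) (q + 1) := by
  induction q using Nat.twoStepInduction with
  | zero => rw [mpIntegral_zero hc, mpMoment_one]
  | one =>
    have h1 := mpIntegral_recursion hc 0
    have h2 := mpMoment_linear_recursion (c ^ 2) 0
    rw [mpIntegral_zero hc] at h1
    rw [mpMoment_one] at h2
    push_cast at h1 h2
    simp only [zero_add, zero_mul, sub_zero, mul_zero] at h1 h2 ⊢
    linear_combination h1 / 3 - (2 * Real.pi / 3) * h2
  | more q h0 h1 =>
    have h2 := mpIntegral_recursion hc (q + 1)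
    have h3 := mpMoment_linear_recursion (c ^ 2) (q + 1)
    rw [Nat.add_sub_cancel, h0, h1] at h2
    have hq : ((q + 1 : ℕ) : ℝ) + 3 ≠ 0 := by positivity
    apply mul_left_cancel₀ hq
    rw [h2]
    linear_combination -(2 * Real.pi) * h3

/-- Only the total mass needs this primitive: in positive moments the factor 1/x is absorbed. The
arguments of the two arcsines are ±1 at the edges, except in the degenerate case c = 1, where the
second arcsine has coefficient zero. -/
theorem hasDerivAt_mp_antideriv {c x : ℝ} (hc : 0 < c)
    (h : x ∈ Set.Ioo ((c - 1) ^ 2) ((c + 1) ^ 2)) :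
    HasDerivAt (fun x => √(mpPoly c x) + (1 + c ^ 2) * Real.arcsin ((x - 1 - c ^ 2) / (2 * c))
      - |1 - c ^ 2| * Real.arcsin ((1 + c ^ 2) / (2 * c) - (1 - c ^ 2) ^ 2 / (2 * c * x)))
      (√(mpPoly c x) / x) x := by
  have hx : 0 < x := lt_of_le_of_lt (sq_nonneg _) h.1
  have hpos := mpPoly_pos h
  set S := √(mpPoly c x) with hS
  have hS0 : 0 < S := Real.sqrt_pos.2 hpos
  have hSS : S ^ 2 = mpPoly c x := Real.sq_sqrt hpos.le
  have hP : mpPoly c x = -x * x + 2 * (1 + c ^ 2) * x - (1 - c ^ 2) ^ 2 := by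
    unfold mpPoly; ring
  have e1 : 1 - ((x - 1 - c ^ 2) / (2 * c)) ^ 2 = (S / (2 * c)) ^ 2 := by
    rw [div_pow, div_pow, hSS, mpPoly]
    field_simp
    ring
  have h1 : HasDerivAt (fun x => Real.arcsin ((x - 1 - c ^ 2) / (2 * c))) (1 / S) x := by
    have hin : HasDerivAt (fun x => (x - 1 - c ^ 2) / (2 * c)) (1 / (2 * c)) x :=
      (((hasDerivAt_id x).sub_const 1).sub_const (c ^ 2)).div_const (2 * c)
    have hne : 0 < 1 - ((x - 1 - c ^ 2) / (2 * c)) ^ 2 := by rw [e1]; positivity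
    have := (Real.hasDerivAt_arcsin (x := (x - 1 - c ^ 2) / (2 * c))
      (by rintro h'; rw [h'] at hne; norm_num at hne)
      (by rintro h'; rw [h'] at hne; norm_num at hne)).comp x hin
    refine this.congr_deriv ?_
    rw [e1, Real.sqrt_sq (by positivity)]
    field_simp
  have h2 : HasDerivAt (fun x => |1 - c ^ 2| *
      Real.arcsin ((1 + c ^ 2) / (2 * c) - (1 - c ^ 2) ^ 2 / (2 * c * x)))
      ((1 - c ^ 2) ^ 2 / (x * S)) x := by
    by_cases hc1 : 1 - c ^ 2 = 0
    · simpa [hc1] using hasDerivAt_const x (0 : ℝ)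
    have habs : 0 < |1 - c ^ 2| := abs_pos.2 hc1
    set v := (1 + c ^ 2) / (2 * c) - (1 - c ^ 2) ^ 2 / (2 * c * x) with hv
    have e2 : 1 - v ^ 2 = (|1 - c ^ 2| * S / (2 * c * x)) ^ 2 := by
      rw [div_pow, mul_pow, sq_abs, hSS, hP, hv]
      field_simp
      ring
    have hin : HasDerivAt (fun x => (1 + c ^ 2) / (2 * c) - (1 - c ^ 2) ^ 2 / (2 * c * x))
        ((1 - c ^ 2) ^ 2 / (2 * c * x ^ 2)) x := by
      have hi := ((hasDerivAt_inv hx.ne').const_mul ((1 - c ^ 2) ^ 2 / (2 * c))).const_sub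
        ((1 + c ^ 2) / (2 * c))
      have hfun : (fun x => (1 + c ^ 2) / (2 * c) - (1 - c ^ 2) ^ 2 / (2 * c * x)) =
          fun x => (1 + c ^ 2) / (2 * c) - (1 - c ^ 2) ^ 2 / (2 * c) * x⁻¹ := by
        ext y
        ring
      rw [hfun]
      refine hi.congr_deriv ?_
      field_simp
    have hne : 0 < 1 - v ^ 2 := by rw [e2]; positivity
    have := ((Real.hasDerivAt_arcsin (x := v)
      (by rintro h'; rw [h'] at hne; norm_num at hne)
      (by rintro h'; rw [h'] at hne; norm_num at hne)).comp x hin).const_mul |1 - c ^ 2|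
    refine this.congr_deriv ?_
    rw [e2, Real.sqrt_sq (by positivity)]
    field_simp
  have := ((hasDerivAt_sqrt_mpPoly h).add (h1.const_mul (1 + c ^ 2))).sub h2
  refine this.congr_deriv ?_
  rw [← hS]
  field_simp
  rw [hSS, hP]
  ring

theorem continuousOn_mp_antideriv {c : ℝ} (hc : 0 < c) :
    ContinuousOn (fun x => √(mpPoly c x) + (1 + c ^ 2) * Real.arcsin ((x - 1 - c ^ 2) / (2 * c))
      - |1 - c ^ 2| * Real.arcsin ((1 + c ^ 2) / (2 * c) - (1 - c ^ 2) ^ 2 / (2 * c * x)))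
      (Set.Icc ((c - 1) ^ 2) ((c + 1) ^ 2)) := by
  have hcont := continuous_mpPoly c
  have harc := Real.continuous_arcsin
  refine ContinuousOn.sub (by fun_prop) ?_
  by_cases hc1 : 1 - c ^ 2 = 0
  · simpa [hc1] using continuousOn_const
  have hx : ∀ x ∈ Set.Icc ((c - 1) ^ 2) ((c + 1) ^ 2), 2 * c * x ≠ 0 := by
    intro x hx
    have : 0 < (c - 1) ^ 2 := by
      have : c - 1 ≠ 0 := by
        intro h; apply hc1; rw [sub_eq_zero.1 h]; ring
      positivity
    have := this.trans_le hx.1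
    positivity
  refine continuousOn_const.mul (harc.comp_continuousOn (continuousOn_const.sub ?_))
  exact continuousOn_const.div (by fun_prop) hx

theorem intervalIntegrable_mp_div {c : ℝ} (hc : 0 < c) :
    IntervalIntegrable (fun x => √(mpPoly c x) / x) volume ((c - 1) ^ 2) ((c + 1) ^ 2) := by
  rw [intervalIntegrable_iff_integrableOn_Ioc_of_le (edge_le hc)]
  -- When c = 1 the integrand is unbounded near 0; nonnegativity and a continuous primitive still
  -- give integrability.
  refine intervalIntegral.integrableOn_deriv_of_nonneg (continuousOn_mp_antideriv hc)
    (fun x hx => hasDerivAt_mp_antideriv hc hx) fun x hx => ?_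
  have hx0 : 0 < x := lt_of_le_of_lt (sq_nonneg _) hx.1
  positivity

theorem integral_mp_div {c : ℝ} (hc : 0 < c) :
    ∫ x in ((c - 1) ^ 2)..((c + 1) ^ 2), √(mpPoly c x) / x =
      Real.pi * ((1 + c ^ 2) - |1 - c ^ 2|) := by
  rw [intervalIntegral.integral_eq_sub_of_hasDerivAt_of_le (edge_le hc)
    (continuousOn_mp_antideriv hc) (fun x hx => hasDerivAt_mp_antideriv hc hx)
    (intervalIntegrable_mp_div hc), mpPoly_left, mpPoly_right]
  have e1 : ((c + 1) ^ 2 - 1 - c ^ 2) / (2 * c) = 1 := by field_simp; ring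
  have e2 : ((c - 1) ^ 2 - 1 - c ^ 2) / (2 * c) = -1 := by field_simp; ring
  have e3 : (1 + c ^ 2) / (2 * c) - (1 - c ^ 2) ^ 2 / (2 * c * (c + 1) ^ 2) = 1 := by
    field_simp; ring
  rw [e1, e2, e3, Real.arcsin_one, Real.arcsin_neg_one]
  by_cases hc1 : 1 - c ^ 2 = 0
  · rw [hc1]; simp; ring
  have hc2 : c - 1 ≠ 0 := by
    intro h; apply hc1; rw [sub_eq_zero.1 h]; ring
  have e4 : (1 + c ^ 2) / (2 * c) - (1 - c ^ 2) ^ 2 / (2 * c * (c - 1) ^ 2) = -1 := by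
    field_simp; ring
  rw [e4, Real.arcsin_neg_one]
  ring

end Integrals

open EntanglementSwapping

/-! ### Mass, support and moments of the limit law -/

section MarchenkoPastur

/-- The density of the absolutely continuous part of the Marchenko-Pastur distribution. -/
noncomputable def mpDensity (c x : ℝ) : ℝ := √(mpPoly c x) / (2 * Real.pi * x)

theorem measurable_mpDensity (c : ℝ) : Measurable (mpDensity c) := by
  unfold mpDensity
  have := (continuous_mpPoly c).measurable
  fun_prop

theorem mpDensity_nonneg {c x : ℝ} (hx : x ∈ Set.Icc ((c - 1) ^ 2) ((c + 1) ^ 2)) :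
    0 ≤ mpDensity c x := by
  have : 0 ≤ x := (sq_nonneg _).trans hx.1
  unfold mpDensity
  positivity

theorem integrableOn_mpDensity {c : ℝ} (hc : 0 < c) :
    IntegrableOn (mpDensity c) (Set.Icc ((c - 1) ^ 2) ((c + 1) ^ 2)) := by
  rw [integrableOn_Icc_iff_integrableOn_Ioc]
  have h := (intervalIntegrable_mp_div hc).const_mul (2 * Real.pi)⁻¹
  rw [intervalIntegrable_iff_integrableOn_Ioc_of_le (edge_le hc)] at h
  refine h.congr_fun (fun x _ => ?_) measurableSet_Ioc
  simp only [mpDensity]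
  rw [div_mul_eq_div_div_swap]
  ring

theorem setIntegral_mpDensity {c : ℝ} (hc : 0 < c) :
    ∫ x in Set.Icc ((c - 1) ^ 2) ((c + 1) ^ 2), mpDensity c x =
      ((1 + c ^ 2) - |1 - c ^ 2|) / 2 := by
  rw [integral_Icc_eq_integral_Ioc, ← intervalIntegral.integral_of_le (edge_le hc)]
  have : ∀ x, mpDensity c x = (2 * Real.pi)⁻¹ * (√(mpPoly c x) / x) := by
    intro x
    simp only [mpDensity]
    rw [div_mul_eq_div_div_swap]
    ring
  simp only [this, intervalIntegral.integral_const_mul, integral_mp_div hc]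
  have := Real.pi_pos
  field_simp

/-- The absolutely continuous part of the Marchenko-Pastur distribution. -/
noncomputable def mpContinuousPart (c : ℝ) : Measure ℝ :=
  (volume.restrict (Set.Icc ((c - 1) ^ 2) ((c + 1) ^ 2))).withDensity
    (fun x => ENNReal.ofReal (mpDensity c x))

theorem marchenkoPastur_eq {c : ℝ} (hc : 0 < c) :
    marchenkoPastur (c ^ 2) =
      ENNReal.ofReal (1 - c ^ 2) • Measure.dirac 0 + mpContinuousPart c := by
  rw [marchenkoPastur, Real.sqrt_sq hc.le]
  rfl

theorem mpContinuousPart_univ {c : ℝ} (hc : 0 < c) :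
    mpContinuousPart c Set.univ = ENNReal.ofReal (((1 + c ^ 2) - |1 - c ^ 2|) / 2) := by
  rw [mpContinuousPart, withDensity_apply _ MeasurableSet.univ, Measure.restrict_univ,
    ← setIntegral_mpDensity hc, ofReal_integral_eq_lintegral_ofReal (integrableOn_mpDensity hc)]
  exact (ae_restrict_iff' measurableSet_Icc).2 (ae_of_all _ fun x hx => mpDensity_nonneg hx)

theorem isProbabilityMeasure_marchenkoPastur {c : ℝ} (hc : 0 < c) :
    IsProbabilityMeasure (marchenkoPastur (c ^ 2)) := by
  constructor
  rw [marchenkoPastur_eq hc, Measure.add_apply, mpContinuousPart_univ hc, Measure.smul_apply,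
    measure_univ, smul_eq_mul, mul_one]
  rcases le_total 0 (1 - c ^ 2) with h | h
  · rw [abs_of_nonneg h, ← ENNReal.ofReal_add h (by nlinarith), ← ENNReal.ofReal_one]
    congr 1
    ring
  · rw [abs_of_nonpos h, ENNReal.ofReal_of_nonpos h, zero_add, ← ENNReal.ofReal_one]
    congr 1
    ring

theorem ae_marchenkoPastur {c : ℝ} (hc : 0 < c) :
    ∀ᵐ x ∂(marchenkoPastur (c ^ 2)), x ∈ Set.Icc 0 ((c + 1) ^ 2) := by
  rw [marchenkoPastur_eq hc, ae_add_measure_iff]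
  constructor
  · refine Measure.ae_smul_measure ?_ _
    exact (ae_dirac_iff (p := fun x : ℝ => x ∈ Set.Icc 0 ((c + 1) ^ 2)) measurableSet_Icc).2
      ⟨le_rfl, sq_nonneg _⟩
  · refine (withDensity_absolutelyContinuous _ _).ae_le ?_
    refine (ae_restrict_iff' measurableSet_Icc).2 (ae_of_all _ fun x hx => ?_)
    exact ⟨(sq_nonneg _).trans hx.1, hx.2⟩

theorem integrable_pow_marchenkoPastur {c : ℝ} (hc : 0 < c) (p : ℕ) :
    Integrable (fun x => x ^ p) (marchenkoPastur (c ^ 2)) := by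
  have := isProbabilityMeasure_marchenkoPastur hc
  refine Integrable.of_bound (by fun_prop) (((c + 1) ^ 2) ^ p) ?_
  filter_upwards [ae_marchenkoPastur hc] with x hx
  rw [norm_pow, Real.norm_of_nonneg hx.1]
  exact pow_le_pow_left₀ hx.1 hx.2 p

theorem integral_pow_marchenkoPastur {c : ℝ} (hc : 0 < c) (p : ℕ) :
    ∫ x, x ^ p ∂(marchenkoPastur (c ^ 2)) = mpMoment (c ^ 2) p := by
  have hprob := isProbabilityMeasure_marchenkoPastur hc
  cases p with
  | zero => simp [mpMoment_zero]
  | succ q =>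
    have hint := integrable_pow_marchenkoPastur hc (q + 1)
    rw [marchenkoPastur_eq hc] at hint ⊢
    rw [integral_add_measure hint.left_of_add_measure hint.right_of_add_measure,
      integral_smul_measure, integral_dirac, mpContinuousPart,
      integral_withDensity_eq_integral_toReal_smul
        ((measurable_mpDensity c).ennreal_ofReal) (by simp)]
    have h1 : ∫ x in Set.Icc ((c - 1) ^ 2) ((c + 1) ^ 2),
        (ENNReal.ofReal (mpDensity c x)).toReal • x ^ (q + 1) =
        ∫ x in Set.Icc ((c - 1) ^ 2) ((c + 1) ^ 2),
          (2 * Real.pi)⁻¹ * (x ^ q * √(mpPoly c x)) := by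
      refine setIntegral_congr_fun measurableSet_Icc fun x hx => ?_
      rw [ENNReal.toReal_ofReal (mpDensity_nonneg hx), mpDensity, smul_eq_mul]
      -- At 0 the quotient is 0 by convention; the other side also vanishes, as `mpPoly c 0` equals
      -- -(1 - c²)² and its root is 0.
      by_cases hx0 : x = 0
      · subst hx0
        have : mpPoly c 0 ≤ 0 := by unfold mpPoly; nlinarith [sq_nonneg (1 - c ^ 2)]
        simp [Real.sqrt_eq_zero_of_nonpos this]
      · field_simp
        ring
    rw [h1, integral_Icc_eq_integral_Ioc, ← intervalIntegral.integral_of_le (edge_le hc),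
      intervalIntegral.integral_const_mul]
    have h2 := mpIntegral_eq hc q
    rw [mpIntegral] at h2
    rw [h2]
    have := Real.pi_pos
    simp only [ne_eq, Nat.add_eq_zero_iff, one_ne_zero, and_false, not_false_eq_true, zero_pow,
      smul_zero, zero_add]
    field_simp

/-- The moments of the centered and rescaled Marchenko-Pastur distribution. -/
noncomputable def centeredMoment (c : ℝ) (p : ℕ) : ℝ :=
  ∑ k ∈ Finset.range (p + 1), mpMoment (c ^ 2) k / c ^ k * (-c) ^ (p - k) * (p.choose k)

theorem measurable_centering (c : ℝ) : Measurable fun x : ℝ => (x - c ^ 2) / c := by fun_prop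

theorem isProbabilityMeasure_centeredRescaled {c : ℝ} (hc : 0 < c) :
    IsProbabilityMeasure (centeredRescaledMarchenkoPastur c) := by
  have := isProbabilityMeasure_marchenkoPastur hc
  exact Measure.isProbabilityMeasure_map (measurable_centering c).aemeasurable

theorem integral_pow_centeredRescaled {c : ℝ} (hc : 0 < c) (p : ℕ) :
    ∫ x, x ^ p ∂(centeredRescaledMarchenkoPastur c) = centeredMoment c p := by
  rw [centeredRescaledMarchenkoPastur, integral_map (measurable_centering c).aemeasurable
    (by fun_prop)]
  have : ∀ x : ℝ, ((x - c ^ 2) / c) ^ p =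
      ∑ k ∈ Finset.range (p + 1), x ^ k * ((c ^ k)⁻¹ * (-c) ^ (p - k) * (p.choose k)) := by
    intro x
    have : (x - c ^ 2) / c = x / c + -c := by field_simp; ring
    rw [this, add_pow]
    refine Finset.sum_congr rfl fun k _ => ?_
    rw [div_pow]
    ring
  simp only [this]
  rw [integral_finsetSum _ fun k _ => (integrable_pow_marchenkoPastur hc k).mul_const _]
  refine Finset.sum_congr rfl fun k _ => ?_
  rw [integral_mul_const, integral_pow_marchenkoPastur hc]
  ring

theorem ae_centeredRescaled {c : ℝ} (hc : 0 < c) :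
    ∃ K : ℝ, ∀ᵐ x ∂(centeredRescaledMarchenkoPastur c), |x| ≤ K := by
  refine ⟨((c + 1) ^ 2 + c ^ 2) / c, ?_⟩
  rw [centeredRescaledMarchenkoPastur, ae_map_iff (measurable_centering c).aemeasurable
    (measurableSet_le (by fun_prop) (by fun_prop))]
  filter_upwards [ae_marchenkoPastur hc] with x hx
  rw [abs_div, abs_of_pos hc]
  gcongr
  rw [abs_le]
  constructor <;> nlinarith [hx.1, hx.2, sq_nonneg c, sq_nonneg (c + 1)]

end MarchenkoPastur

/-! ### Mixed moments of a standard complex Gaussian -/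

section ComplexGaussian

theorem measurable_toComplex :
    Measurable fun p : ℝ × ℝ => (p.1 : ℂ) + (p.2 : ℂ) * Complex.I := by fun_prop

instance : IsProbabilityMeasure stdComplexGaussian :=
  Measure.isProbabilityMeasure_map measurable_toComplex.aemeasurable

theorem integrable_pow_mul_conj_pow (a b : ℕ) :
    Integrable (fun z : ℂ => z ^ a * (starRingEnd ℂ z) ^ b) stdComplexGaussian := by
  have hm : MemLp (fun p : ℝ × ℝ => (p.1 : ℂ) + (p.2 : ℂ) * Complex.I) ((a + b : ℕ) : ℝ≥0∞)
      ((gaussianReal 0 (1 / 2)).prod (gaussianReal 0 (1 / 2))) := by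
    have h := memLp_id_gaussianReal' (μ := 0) (v := 1 / 2) ((a + b : ℕ) : ℝ≥0∞)
      (ENNReal.natCast_ne_top _)
    have h1 := (h.comp_fst (gaussianReal 0 (1 / 2))).ofReal (K := ℂ)
    have h2 := (h.comp_snd (gaussianReal 0 (1 / 2))).ofReal (K := ℂ)
    exact h1.add (h2.mul_const Complex.I)
  have h3 := hm.integrable_norm_pow'
  rw [stdComplexGaussian, integrable_map_measure (by fun_prop) measurable_toComplex.aemeasurable]
  refine h3.mono' (by fun_prop) (ae_of_all _ fun p => ?_)
  simp only [Function.comp, norm_mul, norm_pow, RCLike.norm_conj]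
  rw [pow_add]

theorem gaussian_prod_eq :
    (gaussianReal 0 (1 / 2)).prod (gaussianReal 0 (1 / 2)) =
      (volume : Measure (ℝ × ℝ)).withDensity
        (fun p => ENNReal.ofReal (Real.pi⁻¹ * Real.exp (-(p.1 ^ 2 + p.2 ^ 2)))) := by
  rw [gaussianReal_of_var_ne_zero _ (by norm_num),
    prod_withDensity (measurable_gaussianPDF _ _) (measurable_gaussianPDF _ _),
    ← Measure.volume_eq_prod]
  congr 1
  ext p
  rw [gaussianPDF, gaussianPDF, ← ENNReal.ofReal_mul (gaussianPDFReal_nonneg _ _ _)]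
  congr 1
  simp only [gaussianPDFReal, sub_zero]
  have hpi := Real.pi_pos
  have e : (2 * Real.pi * ((1 / 2 : ℝ≥0) : ℝ)) = Real.pi := by
    push_cast; ring
  have e' : (2 * ((1 / 2 : ℝ≥0) : ℝ)) = 1 := by push_cast; ring
  rw [e, e', mul_mul_mul_comm, ← Real.exp_add, ← mul_inv, Real.mul_self_sqrt hpi.le]
  congr 2
  ring

theorem integral_exp_mul_I_int (n : ℤ) :
    ∫ θ in Set.Ioo (-Real.pi) Real.pi, Complex.exp (n * θ * Complex.I) =
      if n = 0 then 2 * (Real.pi : ℂ) else 0 := by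
  rw [← integral_Ioc_eq_integral_Ioo, ← intervalIntegral.integral_of_le
    (by linarith [Real.pi_pos])]
  split_ifs with h
  · subst h
    simp
    ring
  · have hc : (n : ℂ) * Complex.I ≠ 0 := by simp [h]
    have h1 := integral_exp_mul_complex (a := -Real.pi) (b := Real.pi) hc
    have h2 : ∀ θ : ℝ, (n : ℂ) * θ * Complex.I = n * Complex.I * θ := fun θ => by ring
    simp only [h2]
    rw [h1]
    have h3 : Complex.exp (n * Complex.I * (Real.pi : ℝ)) =
        Complex.exp (n * Complex.I * ((-Real.pi : ℝ) : ℂ)) := by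
      rw [Complex.exp_eq_exp_iff_exists_int]
      exact ⟨n, by push_cast; ring⟩
    rw [h3, sub_self, zero_div]

theorem integral_pow_mul_exp_neg_sq (a : ℕ) :
    ∫ r in Set.Ioi (0 : ℝ), r ^ (2 * a + 1) * Real.exp (-r ^ 2) = (a.factorial : ℝ) / 2 := by
  have h := integral_rpow_mul_exp_neg_rpow (p := 2) (q := 2 * a + 1) (by norm_num)
    (by have : (0 : ℝ) ≤ a := Nat.cast_nonneg a
        linarith)
  have e : ((2 : ℝ) * a + 1 + 1) / 2 = a + 1 := by ring
  rw [e, Real.Gamma_nat_eq_factorial] at h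
  rw [show (a.factorial : ℝ) / 2 = 1 / 2 * a.factorial by ring, ← h]
  refine setIntegral_congr_fun measurableSet_Ioi fun r _ => ?_
  rw [Real.rpow_two, ← Real.rpow_natCast]
  push_cast
  rfl

/-- In polar coordinates the angular integral kills all terms with a ≠ b, and the radial one is a
Gamma integral. -/
theorem integral_pow_mul_conj_pow (a b : ℕ) :
    ∫ z, z ^ a * (starRingEnd ℂ z) ^ b ∂stdComplexGaussian =
      if a = b then (a.factorial : ℂ) else 0 := by
  rw [stdComplexGaussian, integral_map measurable_toComplex.aemeasurable (by fun_prop),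
    gaussian_prod_eq, integral_withDensity_eq_integral_toReal_smul (by fun_prop) (by simp),
    ← integral_comp_polarCoord_symm]
  have hpi := Real.pi_pos
  have h1 : ∀ p ∈ polarCoord.target, p.1 •
      ((ENNReal.ofReal (Real.pi⁻¹ * Real.exp
        (-((polarCoord.symm p).1 ^ 2 + (polarCoord.symm p).2 ^ 2)))).toReal •
      ((((polarCoord.symm p).1 : ℂ) + ((polarCoord.symm p).2 : ℂ) * Complex.I) ^ a *
        (starRingEnd ℂ
          (((polarCoord.symm p).1 : ℂ) + ((polarCoord.symm p).2 : ℂ) * Complex.I)) ^ b)) =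
      (((Real.pi⁻¹ * (p.1 ^ (a + b + 1) * Real.exp (-p.1 ^ 2)) : ℝ) : ℂ)) *
        Complex.exp (((a : ℤ) - (b : ℤ) : ℤ) * p.2 * Complex.I) := by
    rintro ⟨r, θ⟩ -
    simp only [polarCoord_symm_apply]
    have e1 : (r * Real.cos θ) ^ 2 + (r * Real.sin θ) ^ 2 = r ^ 2 := by
      rw [mul_pow, mul_pow, ← mul_add, Real.cos_sq_add_sin_sq, mul_one]
    have e2 : (((r * Real.cos θ : ℝ) : ℂ) + ((r * Real.sin θ : ℝ) : ℂ) * Complex.I) =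
        r * Complex.exp (θ * Complex.I) := by
      rw [Complex.exp_mul_I]
      push_cast
      ring
    have e3 : starRingEnd ℂ (r * Complex.exp (θ * Complex.I)) =
        r * Complex.exp (-(θ * Complex.I)) := by
      rw [map_mul, Complex.conj_ofReal, ← Complex.exp_conj, map_mul, Complex.conj_ofReal,
        Complex.conj_I, mul_neg]
    rw [e1, e2, e3, ENNReal.toReal_ofReal (by positivity), mul_pow, mul_pow, ← Complex.exp_nat_mul,
      ← Complex.exp_nat_mul]
    have e4 : Complex.exp (((a : ℤ) - (b : ℤ) : ℤ) * θ * Complex.I) =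
        Complex.exp (a * (θ * Complex.I)) * Complex.exp (b * -(θ * Complex.I)) := by
      rw [← Complex.exp_add]
      congr 1
      push_cast
      ring
    rw [e4]
    simp only [Complex.real_smul]
    push_cast
    ring
  rw [setIntegral_congr_fun polarCoord.open_target.measurableSet h1]
  have h2 : polarCoord.target = Set.Ioi (0 : ℝ) ×ˢ Set.Ioo (-Real.pi) Real.pi := rfl
  rw [h2, Measure.volume_eq_prod, setIntegral_prod_mul
    (fun r : ℝ => ((Real.pi⁻¹ * (r ^ (a + b + 1) * Real.exp (-r ^ 2)) : ℝ) : ℂ))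
    (fun θ : ℝ => Complex.exp (((a : ℤ) - (b : ℤ) : ℤ) * θ * Complex.I)),
    integral_exp_mul_I_int]
  by_cases hab : a = b
  · subst hab
    rw [integral_complex_ofReal, integral_const_mul, ← two_mul, integral_pow_mul_exp_neg_sq]
    simp only [sub_self, if_true]
    push_cast
    field_simp
  · have : ((a : ℤ) - (b : ℤ)) ≠ 0 := by omega
    rw [if_neg this, if_neg hab, mul_zero]

end ComplexGaussian

/-! ### Wick's formula -/

section Wick

variable {T ι : Type*} [Fintype T] [Fintype ι] [DecidableEq ι]

theorem prod_gaussian_eq (x y : T → ι) (g : ι → ℂ) :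
    (∏ t, g (x t) * starRingEnd ℂ (g (y t))) =
      ∏ e, (g e ^ Fintype.card {t // x t = e} *
        (starRingEnd ℂ (g e)) ^ Fintype.card {t // y t = e}) := by
  rw [Finset.prod_mul_distrib, Finset.prod_mul_distrib]
  congr 1
  · rw [← Finset.prod_fiberwise Finset.univ x]
    refine Finset.prod_congr rfl fun e _ => ?_
    rw [Fintype.card_subtype]
    exact Finset.prod_eq_pow_card fun t ht => by rw [(Finset.mem_filter.1 ht).2]
  · rw [← Finset.prod_fiberwise Finset.univ y]
    refine Finset.prod_congr rfl fun e _ => ?_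
    rw [Fintype.card_subtype]
    exact Finset.prod_eq_pow_card fun t ht => by rw [(Finset.mem_filter.1 ht).2]

theorem integrable_prod_gaussian (x y : T → ι) :
    Integrable (fun g : ι → ℂ => ∏ t, g (x t) * starRingEnd ℂ (g (y t)))
      (Measure.pi fun _ => stdComplexGaussian) := by
  simp only [prod_gaussian_eq]
  exact Integrable.fintype_prod (f := fun e (z : ℂ) => z ^ Fintype.card {t // x t = e} *
    (starRingEnd ℂ z) ^ Fintype.card {t // y t = e}) fun e => integrable_pow_mul_conj_pow _ _

variable [DecidableEq T]

/-- A permutation intertwining two colourings is a family of bijections between the colour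
classes. -/
def intertwinerEquiv (x y : T → ι) :
    {α : Equiv.Perm T // ∀ t, x t = y (α t)} ≃ ∀ e : ι, {t // x t = e} ≃ {t // y t = e} where
  toFun α e := α.1.subtypeEquiv fun t => by rw [α.2 t]
  invFun f := ⟨Equiv.ofFiberEquiv f, fun t => (Equiv.ofFiberEquiv_map f t).symm⟩
  left_inv α := by
    ext t
    rfl
  right_inv f := by
    ext e ⟨t, rfl⟩
    rfl

/-- This product of factorials matches, colour by colour, the Gaussian mixed moments, which is all
that Wick's formula says. -/
theorem card_intertwiners (x y : T → ι) :
    (Finset.univ.filter fun α : Equiv.Perm T => ∀ t, x t = y (α t)).card =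
      ∏ e : ι, if Fintype.card {t // x t = e} = Fintype.card {t // y t = e} then
        (Fintype.card {t // x t = e}).factorial else 0 := by
  rw [← Fintype.card_subtype, Fintype.card_congr (intertwinerEquiv x y), Fintype.card_pi]
  refine Finset.prod_congr rfl fun e _ => ?_
  split_ifs with h
  · exact Fintype.card_equiv (Fintype.equivOfCardEq h)
  · rw [Fintype.card_eq_zero_iff]
    exact ⟨fun f => h (Fintype.card_congr f)⟩

/-- Wick's formula for independent standard complex Gaussian variables. -/
theorem integral_prod_gaussian (x y : T → ι) :
    ∫ g : ι → ℂ, ∏ t, g (x t) * starRingEnd ℂ (g (y t))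
      ∂(Measure.pi fun _ => stdComplexGaussian) =
      ((Finset.univ.filter fun α : Equiv.Perm T => ∀ t, x t = y (α t)).card : ℂ) := by
  simp only [prod_gaussian_eq]
  rw [integral_fintype_prod_eq_prod (f := fun e (z : ℂ) => z ^ Fintype.card {t // x t = e} *
    (starRingEnd ℂ z) ^ Fintype.card {t // y t = e}), card_intertwiners]
  push_cast
  refine Finset.prod_congr rfl fun e _ => ?_
  rw [integral_pow_mul_conj_pow]

end Wick

/-! ### Mixed moments of Wishart entries -/

section WishartMoments

variable {T n : Type*} [Fintype T] [DecidableEq T]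

theorem prod_wishartMap (s : ℕ) (x y : T → n) (g : n × Fin s → ℂ) :
    ∏ t, wishartMap s g (x t) (y t) =
      ∑ a : T → Fin s, ∏ t, g (x t, a t) * starRingEnd ℂ (g (y t, a t)) := by
  simp only [wishartMap, Matrix.mul_apply, Matrix.conjTranspose_apply, Matrix.of_apply]
  rw [Finset.prod_univ_sum, Fintype.piFinset_univ]
  rfl

variable [Fintype n] [DecidableEq n]

theorem integrable_prod_wishartMap (s : ℕ) (x y : T → n) :
    Integrable (fun g : n × Fin s → ℂ => ∏ t, wishartMap s g (x t) (y t))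
      (Measure.pi fun _ => stdComplexGaussian) := by
  simp only [prod_wishartMap]
  exact integrable_finsetSum _ fun a _ =>
    integrable_prod_gaussian (fun t => (x t, a t)) (fun t => (y t, a t))

/-- The summed column labels must be constant along the cycles of the Wick pairing, which leaves s
choices per cycle. -/
theorem integral_prod_wishartMap (s : ℕ) (x y : T → n) :
    ∫ g : n × Fin s → ℂ, ∏ t, wishartMap s g (x t) (y t)
      ∂(Measure.pi fun _ => stdComplexGaussian) =
      ∑ α : Equiv.Perm T, if ∀ t, x t = y (α t) then (s : ℂ) ^ numCycles α else 0 := by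
  simp only [prod_wishartMap]
  rw [integral_finsetSum _ fun a _ =>
    integrable_prod_gaussian (fun t => (x t, a t)) (fun t => (y t, a t))]
  have h : ∀ a : T → Fin s, ∫ g : n × Fin s → ℂ,
      ∏ t, g (x t, a t) * starRingEnd ℂ (g (y t, a t))
        ∂(Measure.pi fun _ => stdComplexGaussian) =
      ∑ α : Equiv.Perm T, if (∀ t, x t = y (α t)) ∧ ∀ t, a (α t) = a t then (1 : ℂ) else 0 := by
    intro a
    rw [integral_prod_gaussian (fun t => (x t, a t)) (fun t => (y t, a t)), Finset.card_filter]
    push_cast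
    refine Finset.sum_congr rfl fun α _ => ?_
    congr 1
    simp only [Prod.mk.injEq, forall_and, eq_comm]
  simp only [h]
  rw [Finset.sum_comm]
  refine Finset.sum_congr rfl fun α _ => ?_
  split_ifs with hα
  · simp only [hα, implies_true, true_and]
    rw [Finset.sum_boole, card_invariant_functions, Fintype.card_fin]
    push_cast
    rfl
  · simp [hα]

end WishartMoments

/-! ### Traces of powers as sums over index cycles -/

section CyclicTrace

variable {T T' n R : Type*} [Fintype T] [Fintype T'] [Fintype n] [CommRing R]

/-- The product, over the cycles of `π`, of the traces of the powers of `A` given by the cycle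
lengths. -/
noncomputable def cyclicTrace (π : Equiv.Perm T) (A : Matrix n n R) : R :=
  letI := Classical.decEq T
  ∑ κ : T → n, ∏ t, A (κ t) (κ (π t))

theorem cyclicTrace_eq [DecidableEq T] (π : Equiv.Perm T) (A : Matrix n n R) :
    cyclicTrace π A = ∑ κ : T → n, ∏ t, A (κ t) (κ (π t)) := by
  unfold cyclicTrace
  congr!

/-- This brings second moments of traces under the same Wick computation as first moments. -/
theorem cyclicTrace_sumCongr (π : Equiv.Perm T) (ρ : Equiv.Perm T') (A : Matrix n n R) :
    cyclicTrace (Equiv.Perm.sumCongr π ρ) A = cyclicTrace π A * cyclicTrace ρ A := by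
  classical
  rw [cyclicTrace_eq, cyclicTrace_eq, cyclicTrace_eq, Finset.sum_mul_sum,
    ← Fintype.sum_prod_type', ← (Equiv.sumArrowEquivProdArrow T T' n).sum_comp]
  refine Finset.sum_congr rfl fun κ _ => ?_
  rw [Fintype.prod_sum_type]
  rfl

theorem pow_succ_apply_eq_sum [DecidableEq n] (A : Matrix n n R) (p : ℕ) (x y : n) :
    (A ^ (p + 1)) x y = ∑ k : Fin p → n, ∏ t : Fin (p + 1),
      A (Fin.cons (α := fun _ => n) x k t) (Fin.snoc (α := fun _ => n) k y t) := by
  induction p generalizing x with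
  | zero => simp [Fin.snoc]
  | succ p ih =>
    rw [pow_succ', Matrix.mul_apply, ← (Fin.consEquiv fun _ => n).sum_comp,
      Fintype.sum_prod_type]
    refine Finset.sum_congr rfl fun z _ => ?_
    rw [ih z, Finset.mul_sum]
    refine Finset.sum_congr rfl fun k _ => ?_
    conv_rhs => rw [Fin.prod_univ_succ]
    congr 1
    refine Finset.prod_congr rfl fun t _ => ?_
    simp only [Fin.cons_succ, Fin.consEquiv_apply]
    congr 1
    have h := congrFun (Fin.cons_snoc_eq_snoc_cons z k y) t.succ
    rw [Fin.cons_succ] at h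
    exact h

theorem trace_pow_succ [DecidableEq n] (A : Matrix n n R) (p : ℕ) :
    (A ^ (p + 1)).trace = cyclicTrace (finRotate (p + 1)) A := by
  rw [cyclicTrace_eq, Matrix.trace, ← (Fin.consEquiv fun _ => n).sum_comp, Fintype.sum_prod_type]
  refine Finset.sum_congr rfl fun x _ => ?_
  rw [Matrix.diag_apply, pow_succ_apply_eq_sum]
  refine Finset.sum_congr rfl fun k _ => ?_
  refine Finset.prod_congr rfl fun t _ => ?_
  -- On the diagonal the column indices are the row indices rotated by one step.
  rw [Fin.snoc_eq_cons_rotate]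
  rfl

end CyclicTrace

/-! ### Index contractions in the swapped matrix -/

section SwapMoments

variable {T : Type*} [Fintype T] [DecidableEq T]

/-- The sum over pairs of permutations which gives the expectation of `cyclicTrace π` of the
entanglement swapping of two independent Wishart matrices. -/
noncomputable def swapMoment (d s : ℕ) (π : Equiv.Perm T) : ℝ :=
  ∑ α : Equiv.Perm T, ∑ β : Equiv.Perm T, (s : ℝ) ^ (numCycles α + numCycles β) *
    (d : ℝ) ^ (numCycles (α⁻¹ * π) + numCycles (β⁻¹ * π) + numCycles (β⁻¹ * α))

/-- The entanglement swapping without its normalization. -/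
def unnormalizedSwap {d : ℕ} (W₁ W₂ : Matrix (Fin d × Fin d) (Fin d × Fin d) ℂ) :
    Matrix (Fin d × Fin d) (Fin d × Fin d) ℂ :=
  Matrix.of fun k l => ∑ i : Fin d × Fin d, W₁ (i.1, k.1) (i.2, l.1) * W₂ (i.1, k.2) (i.2, l.2)

theorem bellProjection_apply {d : ℕ} (x y z w : Fin d) :
    bellProjection d (x, y) (z, w) = if x = y ∧ z = w then 1 else 0 := by
  simp only [bellProjection, Matrix.sum_apply, Matrix.kroneckerMap_apply, Matrix.single_apply]
  rw [Finset.sum_eq_single x, Finset.sum_eq_single z]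
  · simp
  · intro j _ hj
    simp [hj]
  · simp
  · intro i _ hi
    simp [hi]
  · simp

/-- Tracing against the Bell projection identifies the two row indices, and the two column indices,
of the contracted factors. -/
theorem swap_eq {d : ℕ} (W₁ W₂ : Matrix (Fin d × Fin d) (Fin d × Fin d) ℂ) :
    EntanglementSwapping.swap W₁ W₂ = (1 / (d : ℂ)) • unnormalizedSwap W₁ W₂ := by
  unfold EntanglementSwapping.swap
  congr 1
  ext k l
  have hR : ∀ x y z w a b : Fin d, reorderedTensor W₁ W₂ ((x, y), k) ((z, w), (a, b)) =
      W₁ (x, k.1) (z, a) * W₂ (y, k.2) (w, b) := fun _ _ _ _ _ _ => rfl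
  have hB : ∀ x y z w a b : Fin d, (bellProjection d ⊗ₖ (1 : Matrix (Fin d × Fin d) _ ℂ))
      ((z, w), (a, b)) ((x, y), l) =
      (if z = w ∧ x = y then 1 else 0) * (1 : Matrix (Fin d × Fin d) _ ℂ) (a, b) l := by
    intro x y z w a b
    rw [← bellProjection_apply]
    rfl
  simp only [partialTraceLeft, unnormalizedSwap, Matrix.of_apply, Matrix.mul_apply,
    Fintype.sum_prod_type, hR, hB]
  refine Finset.sum_congr rfl fun x _ => ?_
  have h : ∀ y z w : Fin d, ∑ a : Fin d, ∑ b : Fin d, W₁ (x, k.1) (z, a) * W₂ (y, k.2) (w, b) *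
      ((if z = w ∧ x = y then 1 else 0) * (1 : Matrix (Fin d × Fin d) _ ℂ) (a, b) l) =
      if z = w ∧ x = y then W₁ (x, k.1) (z, l.1) * W₂ (y, k.2) (w, l.2) else 0 := by
    intro y z w
    rw [Finset.sum_eq_single l.1, Finset.sum_eq_single l.2]
    · simp
    · intro b _ hb
      rw [Matrix.one_apply_ne (fun h => hb (congrArg Prod.snd h))]
      simp
    · simp
    · intro a _ ha
      refine Finset.sum_eq_zero fun b _ => ?_
      rw [Matrix.one_apply_ne (fun h => ha (congrArg Prod.fst h))]
      simp
    · simp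
  simp only [h]
  simp only [ite_and, Finset.sum_ite_eq, Finset.mem_univ, if_true]
  rw [Finset.sum_eq_single x]
  · simp
  · intro y _ hy
    simp [hy.symm]
  · simp

variable {d : ℕ}

theorem cyclicTrace_unnormalizedSwap (π : Equiv.Perm T)
    (W₁ W₂ : Matrix (Fin d × Fin d) (Fin d × Fin d) ℂ) :
    cyclicTrace π (unnormalizedSwap W₁ W₂) =
      ∑ κ : T → Fin d × Fin d, ∑ ι : T → Fin d × Fin d,
        (∏ t, W₁ ((ι t).1, (κ t).1) ((ι t).2, (κ (π t)).1)) *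
        ∏ t, W₂ ((ι t).1, (κ t).2) ((ι t).2, (κ (π t)).2) := by
  rw [cyclicTrace_eq]
  refine Finset.sum_congr rfl fun κ _ => ?_
  simp only [unnormalizedSwap, Matrix.of_apply]
  rw [Finset.prod_univ_sum, Fintype.piFinset_univ]
  simp only [Finset.prod_mul_distrib]

/-- The constraints decouple: the two components of `κ` must be invariant under `π * α` and `π * β`.
The first component of `ι` is determined by the second, which must be invariant under `β * α⁻¹`. -/
theorem sum_intertwined (π α β : Equiv.Perm T) :
    ∑ κ : T → Fin d × Fin d, ∑ ι : T → Fin d × Fin d,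
      ((if ∀ t, ((ι t).1, (κ t).1) = ((ι (α t)).2, (κ (π (α t))).1) then (1 : ℝ) else 0) *
        if ∀ t, ((ι t).1, (κ t).2) = ((ι (β t)).2, (κ (π (β t))).2) then (1 : ℝ) else 0) =
      (d : ℝ) ^ (numCycles (π * α) + numCycles (π * β) + numCycles (β * α⁻¹)) := by
  have hinv : ∀ σ : Equiv.Perm T,
      ∑ k : T → Fin d, (if ∀ t, k t = k (σ t) then (1 : ℝ) else 0) = (d : ℝ) ^ numCycles σ := by
    intro σ
    simp_rw [show ∀ k : T → Fin d, (∀ t, k t = k (σ t)) ↔ ∀ t, k (σ t) = k t from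
      fun k => forall_congr' fun t => eq_comm]
    rw [Finset.sum_boole, card_invariant_functions, Fintype.card_fin]
    push_cast
    rfl
  have hij : ∑ i : T → Fin d, ∑ j : T → Fin d,
      ((if ∀ t, i t = j (α t) then (1 : ℝ) else 0) * if ∀ t, i t = j (β t) then (1 : ℝ) else 0) =
      (d : ℝ) ^ numCycles (β * α⁻¹) := by
    rw [Finset.sum_comm, ← hinv]
    refine Finset.sum_congr rfl fun j _ => ?_
    rw [Finset.sum_eq_single (fun t => j (α t))]
    · simp only [implies_true, if_true, one_mul]
      congr 1
      rw [← α.forall_congr_right (q := fun t => j t = j ((β * α⁻¹) t))]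
      simp
    · intro i _ hi
      rw [if_neg, zero_mul]
      intro h
      exact hi (funext h)
    · simp
  let e := Equiv.arrowProdEquivProdArrow T (fun _ => Fin d) (fun _ => Fin d)
  rw [← e.symm.sum_comp, pow_add, pow_add, ← hij, ← hinv, ← hinv, Fintype.sum_prod_type,
    Finset.sum_mul_sum, Finset.sum_mul]
  refine Finset.sum_congr rfl fun k _ => ?_
  rw [Finset.sum_mul]
  refine Finset.sum_congr rfl fun k' _ => ?_
  rw [← e.symm.sum_comp, Fintype.sum_prod_type, Finset.mul_sum]
  refine Finset.sum_congr rfl fun i _ => ?_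
  rw [Finset.mul_sum]
  refine Finset.sum_congr rfl fun j _ => ?_
  simp only [e, Equiv.arrowProdEquivProdArrow, Equiv.coe_fn_symm_mk, Prod.mk.injEq, forall_and,
    Equiv.Perm.mul_apply]
  have key : ∀ (A B C D : Prop) [Decidable A] [Decidable B] [Decidable C] [Decidable D]
      [Decidable (A ∧ B)] [Decidable (C ∧ D)],
      ((if A ∧ B then (1 : ℝ) else 0) * if C ∧ D then (1 : ℝ) else 0) =
      ((if B then (1 : ℝ) else 0) * if D then (1 : ℝ) else 0) *
        ((if A then (1 : ℝ) else 0) * if C then (1 : ℝ) else 0) := by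
    intro A B C D _ _ _ _ _ _
    by_cases A <;> by_cases B <;> by_cases C <;> by_cases D <;> simp_all
  exact key _ _ _ _

end SwapMoments

/-! ### Expected cyclic traces of the swap -/

section Expectation

variable {Ω : Type*} [MeasurableSpace Ω] {P : Measure Ω} {T : Type*} [Fintype T] {n : Type*}

theorem measurable_prod_entries (x y : T → n) :
    Measurable fun M : Matrix n n ℂ => ∏ t, M (x t) (y t) :=
  Finset.measurable_prod _ fun t _ => (measurable_pi_apply (y t)).comp (measurable_pi_apply (x t))

variable [DecidableEq T] [Fintype n] [DecidableEq n]

theorem integrable_prod_entries {s : ℕ} {W : Ω → Matrix n n ℂ} (hW : HasLaw W (wishart n s) P)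
    (x y : T → n) : Integrable (fun ω => ∏ t, W ω (x t) (y t)) P := by
  have h1 : Integrable (fun M : Matrix n n ℂ => ∏ t, M (x t) (y t)) (wishart n s) := by
    rw [wishart, integrable_map_measure (measurable_prod_entries x y).aestronglyMeasurable
      (measurable_wishartMap s).aemeasurable]
    exact integrable_prod_wishartMap s x y
  rw [← hW.map_eq] at h1
  exact h1.comp_aemeasurable hW.aemeasurable

theorem integral_prod_entries {s : ℕ} {W : Ω → Matrix n n ℂ} (hW : HasLaw W (wishart n s) P)
    (x y : T → n) : ∫ ω, ∏ t, W ω (x t) (y t) ∂P =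
      ∑ α : Equiv.Perm T, if ∀ t, x t = y (α t) then (s : ℂ) ^ numCycles α else 0 := by
  have h := hW.integral_comp (f := fun M : Matrix n n ℂ => ∏ t, M (x t) (y t))
    (measurable_prod_entries x y).aestronglyMeasurable
  rw [wishart, integral_map (measurable_wishartMap s).aemeasurable
    (measurable_prod_entries x y).aestronglyMeasurable, integral_prod_wishartMap] at h
  exact h

variable {d s : ℕ} {W₁ W₂ : Ω → Matrix (Fin d × Fin d) (Fin d × Fin d) ℂ}

theorem integrable_cyclicTrace (hW₁ : HasLaw W₁ (wishart (Fin d × Fin d) s) P)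
    (hW₂ : HasLaw W₂ (wishart (Fin d × Fin d) s) P) (hindep : IndepFun W₁ W₂ P)
    (π : Equiv.Perm T) :
    Integrable (fun ω => cyclicTrace π (unnormalizedSwap (W₁ ω) (W₂ ω))) P := by
  simp only [cyclicTrace_unnormalizedSwap]
  refine integrable_finsetSum _ fun κ _ => integrable_finsetSum _ fun ι _ => ?_
  exact (hindep.comp (measurable_prod_entries _ _) (measurable_prod_entries _ _)).integrable_mul
    (integrable_prod_entries hW₁ _ _) (integrable_prod_entries hW₂ _ _)

theorem integral_cyclicTrace (hW₁ : HasLaw W₁ (wishart (Fin d × Fin d) s) P)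
    (hW₂ : HasLaw W₂ (wishart (Fin d × Fin d) s) P) (hindep : IndepFun W₁ W₂ P)
    (π : Equiv.Perm T) :
    ∫ ω, cyclicTrace π (unnormalizedSwap (W₁ ω) (W₂ ω)) ∂P = (swapMoment d s π : ℂ) := by
  simp only [cyclicTrace_unnormalizedSwap]
  have hI : ∀ κ ι : T → Fin d × Fin d, Integrable (fun ω =>
      (∏ t, W₁ ω ((ι t).1, (κ t).1) ((ι t).2, (κ (π t)).1)) *
        ∏ t, W₂ ω ((ι t).1, (κ t).2) ((ι t).2, (κ (π t)).2)) P := fun κ ι =>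
    (hindep.comp (measurable_prod_entries (fun t => ((ι t).1, (κ t).1))
      (fun t => ((ι t).2, (κ (π t)).1))) (measurable_prod_entries (fun t => ((ι t).1, (κ t).2))
      (fun t => ((ι t).2, (κ (π t)).2)))).integrable_mul
    (integrable_prod_entries hW₁ _ _) (integrable_prod_entries hW₂ _ _)
  have hE : ∀ κ ι : T → Fin d × Fin d, ∫ ω,
      (∏ t, W₁ ω ((ι t).1, (κ t).1) ((ι t).2, (κ (π t)).1)) *
        ∏ t, W₂ ω ((ι t).1, (κ t).2) ((ι t).2, (κ (π t)).2) ∂P =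
      ∑ α : Equiv.Perm T, ∑ β : Equiv.Perm T, ((((s : ℝ) ^ (numCycles α + numCycles β) *
        ((if ∀ t, ((ι t).1, (κ t).1) = ((ι (α t)).2, (κ (π (α t))).1) then (1 : ℝ) else 0) *
        if ∀ t, ((ι t).1, (κ t).2) = ((ι (β t)).2, (κ (π (β t))).2) then (1 : ℝ) else 0) : ℝ))
          : ℂ) := by
    intro κ ι
    have h := (hindep.comp (measurable_prod_entries (fun t => ((ι t).1, (κ t).1))
      (fun t => ((ι t).2, (κ (π t)).1))) (measurable_prod_entries (fun t => ((ι t).1, (κ t).2))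
      (fun t => ((ι t).2, (κ (π t)).2)))).integral_fun_mul_eq_mul_integral
      (integrable_prod_entries hW₁ _ _).aestronglyMeasurable
      (integrable_prod_entries hW₂ _ _).aestronglyMeasurable
    simp only [Function.comp] at h
    rw [h, integral_prod_entries hW₁ (fun t => ((ι t).1, (κ t).1))
      (fun t => ((ι t).2, (κ (π t)).1)), integral_prod_entries hW₂ (fun t => ((ι t).1, (κ t).2))
      (fun t => ((ι t).2, (κ (π t)).2)), Finset.sum_mul_sum]
    refine Finset.sum_congr rfl fun α _ => Finset.sum_congr rfl fun β _ => ?_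
    rw [pow_add]
    split_ifs <;> simp
  rw [integral_finsetSum _ fun κ _ => integrable_finsetSum _ fun ι _ => hI κ ι]
  simp_rw [integral_finsetSum _ fun ι _ => hI _ ι, hE]
  simp only [← Complex.ofReal_sum]
  congr 1
  have h1 : ∑ κ : T → Fin d × Fin d, ∑ ι : T → Fin d × Fin d, ∑ α : Equiv.Perm T,
      ∑ β : Equiv.Perm T, ((s : ℝ) ^ (numCycles α + numCycles β) *
        ((if ∀ t, ((ι t).1, (κ t).1) = ((ι (α t)).2, (κ (π (α t))).1) then (1 : ℝ) else 0) *
        if ∀ t, ((ι t).1, (κ t).2) = ((ι (β t)).2, (κ (π (β t))).2) then (1 : ℝ) else 0)) =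
      ∑ α : Equiv.Perm T, ∑ β : Equiv.Perm T, (s : ℝ) ^ (numCycles α + numCycles β) *
        (d : ℝ) ^ (numCycles (π * α) + numCycles (π * β) + numCycles (β * α⁻¹)) := by
    simp only [Finset.sum_comm (s := (Finset.univ : Finset (T → Fin d × Fin d)))
      (t := (Finset.univ : Finset (Equiv.Perm T)))]
    simp only [← Finset.mul_sum, sum_intertwined]
  -- Replacing both permutations by their inverses puts the exponents in the form used for
  -- geodesics.
  rw [h1, swapMoment, ← Equiv.sum_comp (Equiv.inv (Equiv.Perm T))]
  refine Finset.sum_congr rfl fun α _ => ?_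
  rw [← Equiv.sum_comp (Equiv.inv (Equiv.Perm T))]
  refine Finset.sum_congr rfl fun β _ => ?_
  simp only [Equiv.inv_apply, numCycles_inv, inv_inv]
  rw [numCycles_mul_comm π, numCycles_mul_comm π]

end Expectation

/-! ### Leading terms and the two-degree gap -/

section Exponents

variable {T : Type*} [Fintype T]

/-- The total degree of the term of `swapMoment` indexed by `α` and `β`. -/
noncomputable def degree (π α β : Equiv.Perm T) : ℕ :=
  numCycles α + numCycles β +
    (numCycles (α⁻¹ * π) + numCycles (β⁻¹ * π) + numCycles (β⁻¹ * α))

theorem degree_le (π α β : Equiv.Perm T) :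
    degree π α β ≤ 3 * Fintype.card T + 2 * numCycles π := by
  have h1 := numCycles_add_inv_mul_le α π
  have h2 := numCycles_add_inv_mul_le β π
  have h3 := numCycles_le (β⁻¹ * α)
  unfold degree
  omega

theorem degree_eq_iff (π α β : Equiv.Perm T) :
    degree π α β = 3 * Fintype.card T + 2 * numCycles π ↔ α = β ∧ IsGeodesic α π := by
  have h1 := numCycles_add_inv_mul_le α π
  have h2 := numCycles_add_inv_mul_le β π
  have h3 := numCycles_le (β⁻¹ * α)
  constructor
  · intro h
    have hα : β⁻¹ * α = 1 := by
      by_contra hne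
      have := numCycles_lt_card hne
      unfold degree at h
      omega
    refine ⟨(inv_mul_eq_one.1 hα).symm, ?_⟩
    unfold degree at h
    unfold IsGeodesic
    omega
  · rintro ⟨rfl, h⟩
    unfold IsGeodesic at h
    unfold degree
    rw [inv_mul_cancel, numCycles_one]
    omega

variable {T' : Type*} [Fintype T'] [DecidableEq T] [DecidableEq T']

/-- A geodesic cannot leave the cycles of its endpoint, so it preserves both blocks. -/
theorem IsGeodesic.mem_range_sumCongrHom {α : Equiv.Perm (T ⊕ T')} {π : Equiv.Perm T}
    {ρ : Equiv.Perm T'} (h : IsGeodesic α (Equiv.Perm.sumCongr π ρ)) :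
    α ∈ (Equiv.Perm.sumCongrHom T T').range := by
  refine Equiv.Perm.mem_sumCongrHom_range_of_perm_mapsTo_inl ?_
  rintro _ ⟨t, rfl⟩
  have := h.apply_mem (s := Finset.univ.image Sum.inl) (a := Sum.inl t) (by
    rintro (t | t) <;> simp) (by simp)
  simpa using this

/-- A permutation mixing the blocks is not geodesic and costs a degree. If both mix, that is two; if
only one does, then α ≠ β, and the factor #(β⁻¹α) loses the second degree. -/
theorem degree_add_two_le {α β : Equiv.Perm (T ⊕ T')} {π : Equiv.Perm T} {ρ : Equiv.Perm T'}
    (h : ¬ (α ∈ (Equiv.Perm.sumCongrHom T T').range ∧ β ∈ (Equiv.Perm.sumCongrHom T T').range)) :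
    degree (Equiv.Perm.sumCongr π ρ) α β + 2 ≤
      3 * Fintype.card (T ⊕ T') + 2 * numCycles (Equiv.Perm.sumCongr π ρ) := by
  have h1 := numCycles_add_inv_mul_le α (Equiv.Perm.sumCongr π ρ)
  have h2 := numCycles_add_inv_mul_le β (Equiv.Perm.sumCongr π ρ)
  have h3 := numCycles_le (β⁻¹ * α)
  have h1' : α ∉ (Equiv.Perm.sumCongrHom T T').range →
      numCycles α + numCycles (α⁻¹ * Equiv.Perm.sumCongr π ρ) ≠
        Fintype.card (T ⊕ T') + numCycles (Equiv.Perm.sumCongr π ρ) :=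
    fun hα hg => hα (IsGeodesic.mem_range_sumCongrHom hg)
  have h2' : β ∉ (Equiv.Perm.sumCongrHom T T').range →
      numCycles β + numCycles (β⁻¹ * Equiv.Perm.sumCongr π ρ) ≠
        Fintype.card (T ⊕ T') + numCycles (Equiv.Perm.sumCongr π ρ) :=
    fun hβ hg => hβ (IsGeodesic.mem_range_sumCongrHom hg)
  have h3' : α ≠ β → numCycles (β⁻¹ * α) < Fintype.card (T ⊕ T') := by
    intro hne
    apply numCycles_lt_card
    intro h
    exact hne (inv_mul_eq_one.1 h).symm
  unfold degree
  by_cases hα : α ∈ (Equiv.Perm.sumCongrHom T T').range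
  · have hβ : β ∉ (Equiv.Perm.sumCongrHom T T').range := fun hβ => h ⟨hα, hβ⟩
    have := h2' hβ
    have := h3' (by rintro rfl; exact hβ hα)
    omega
  · by_cases hβ : β ∈ (Equiv.Perm.sumCongrHom T T').range
    · have := h1' hα
      have := h3' (by rintro rfl; exact hα hβ)
      omega
    · have := h1' hα
      have := h2' hβ
      omega

end Exponents

/-! ### Limits of means and decay of covariances -/

section Asymptotics

variable {T : Type*} [Fintype T] [DecidableEq T]

theorem tendsto_monomial {c : ℝ} {s : ℕ → ℕ}
    (hs : Tendsto (fun d : ℕ => (s d : ℝ) / (d : ℝ)) atTop (𝓝 c)) {a b m : ℕ} (h : a + b ≤ m) :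
    Tendsto (fun d : ℕ => (s d : ℝ) ^ a * (d : ℝ) ^ b / (d : ℝ) ^ m) atTop
      (𝓝 (if a + b = m then c ^ a else 0)) := by
  obtain ⟨k, rfl⟩ := Nat.exists_eq_add_of_le h
  have h1 : Tendsto (fun d : ℕ => ((s d : ℝ) / (d : ℝ)) ^ a * ((d : ℝ)⁻¹) ^ k) atTop
      (𝓝 (c ^ a * 0 ^ k)) :=
    (hs.pow a).mul (tendsto_inv_atTop_nhds_zero_nat.pow k)
  have h2 : (if a + b = a + b + k then c ^ a else 0) = c ^ a * 0 ^ k := by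
    cases k <;> simp
  rw [h2]
  refine h1.congr' ?_
  filter_upwards [eventually_gt_atTop 0] with d hd
  have : (d : ℝ) ≠ 0 := by positivity
  rw [pow_add, pow_add, div_pow, inv_pow]
  field_simp

theorem tendsto_swapMoment {c : ℝ} {s : ℕ → ℕ}
    (hs : Tendsto (fun d : ℕ => (s d : ℝ) / (d : ℝ)) atTop (𝓝 c)) (π : Equiv.Perm T) :
    Tendsto (fun d : ℕ => swapMoment d (s d) π /
      (d : ℝ) ^ (3 * Fintype.card T + 2 * numCycles π)) atTop (𝓝 (geodesicSum (c ^ 2) π)) := by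
  classical
  have h : Tendsto (fun d : ℕ => swapMoment d (s d) π /
      (d : ℝ) ^ (3 * Fintype.card T + 2 * numCycles π)) atTop
      (𝓝 (∑ α : Equiv.Perm T, ∑ β : Equiv.Perm T,
        if degree π α β = 3 * Fintype.card T + 2 * numCycles π then
          c ^ (numCycles α + numCycles β) else 0)) := by
    simp only [swapMoment, Finset.sum_div]
    exact tendsto_finsetSum _ fun α _ => tendsto_finsetSum _ fun β _ =>
      tendsto_monomial hs (degree_le π α β)
  convert h using 2
  rw [geodesicSum, Finset.sum_filter]
  refine Finset.sum_congr rfl fun α _ => ?_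
  simp only [degree_eq_iff, ite_and]
  rw [Finset.sum_ite_eq]
  simp only [Finset.mem_univ, if_true]
  split_ifs
  · rw [← pow_mul, two_mul]
  · rfl

/-- Cycle counts add over blocks, so the pairs preserving both blocks contribute exactly the product
of the means. -/
theorem swapMoment_sumCongr_sub {T' : Type*} [Fintype T'] [DecidableEq T'] (d s : ℕ)
    (π : Equiv.Perm T) (ρ : Equiv.Perm T') :
    (open Classical in
    swapMoment d s (Equiv.Perm.sumCongr π ρ) - swapMoment d s π * swapMoment d s ρ =
      ∑ αβ : Equiv.Perm (T ⊕ T') × Equiv.Perm (T ⊕ T') with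
        ¬ (αβ.1 ∈ (Equiv.Perm.sumCongrHom T T').range ∧
          αβ.2 ∈ (Equiv.Perm.sumCongrHom T T').range),
        (s : ℝ) ^ (numCycles αβ.1 + numCycles αβ.2) *
          (d : ℝ) ^ (numCycles (αβ.1⁻¹ * Equiv.Perm.sumCongr π ρ) +
            numCycles (αβ.2⁻¹ * Equiv.Perm.sumCongr π ρ) + numCycles (αβ.2⁻¹ * αβ.1))) := by
  classical
  rw [sub_eq_iff_eq_add', swapMoment, ← Fintype.sum_prod_type', ← Finset.sum_filter_add_sum_filter_not
    Finset.univ (fun αβ : Equiv.Perm (T ⊕ T') × Equiv.Perm (T ⊕ T') =>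
      αβ.1 ∈ (Equiv.Perm.sumCongrHom T T').range ∧ αβ.2 ∈ (Equiv.Perm.sumCongrHom T T').range)]
  congr 1
  rw [swapMoment, swapMoment, ← Fintype.sum_prod_type', ← Fintype.sum_prod_type',
    Finset.sum_mul_sum, ← Fintype.sum_prod_type']
  symm
  refine Finset.sum_bij (fun x _ => (Equiv.Perm.sumCongr x.1.1 x.2.1,
    Equiv.Perm.sumCongr x.1.2 x.2.2)) ?_ ?_ ?_ ?_
  · rintro ⟨⟨α, β⟩, ⟨α', β'⟩⟩ -
    simp only [Finset.mem_filter, Finset.mem_univ, true_and]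
    exact ⟨⟨(α, α'), rfl⟩, ⟨(β, β'), rfl⟩⟩
  · rintro ⟨⟨α, β⟩, ⟨α', β'⟩⟩ - ⟨⟨γ, δ⟩, ⟨γ', δ'⟩⟩ - h
    have hinj := Equiv.Perm.sumCongrHom_injective (α := T) (β := T')
    have h1 := @hinj (α, α') (γ, γ') (congrArg Prod.fst h)
    have h2 := @hinj (β, β') (δ, δ') (congrArg Prod.snd h)
    simp only [Prod.mk.injEq] at h1 h2 ⊢
    exact ⟨⟨h1.1, h2.1⟩, h1.2, h2.2⟩
  · rintro ⟨α, β⟩ h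
    simp only [Finset.mem_filter, Finset.mem_univ, true_and] at h
    obtain ⟨⟨⟨α, α'⟩, rfl⟩, ⟨⟨β, β'⟩, rfl⟩⟩ := h
    exact ⟨((α, β), (α', β')), Finset.mem_univ _, rfl⟩
  · rintro ⟨⟨α, β⟩, ⟨α', β'⟩⟩ -
    simp only [Equiv.Perm.sumCongr_inv, Equiv.Perm.sumCongr_mul, numCycles_sumCongr]
    ring

theorem swapMoment_covariance_isBigO {T' : Type*} [Fintype T'] [DecidableEq T'] {c : ℝ}
    {s : ℕ → ℕ} (hs : Tendsto (fun d : ℕ => (s d : ℝ) / (d : ℝ)) atTop (𝓝 c))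
    (π : Equiv.Perm T) (ρ : Equiv.Perm T') :
    (fun d : ℕ => (swapMoment d (s d) (Equiv.Perm.sumCongr π ρ) -
        swapMoment d (s d) π * swapMoment d (s d) ρ) /
        (d : ℝ) ^ (3 * Fintype.card (T ⊕ T') + 2 * numCycles (Equiv.Perm.sumCongr π ρ)))
      =O[atTop] fun d : ℕ => 1 / (d : ℝ) ^ 2 := by
  classical
  simp only [swapMoment_sumCongr_sub, Finset.sum_div]
  refine Asymptotics.IsBigO.fun_sum fun αβ hαβ => ?_
  have hdeg := degree_add_two_le (π := π) (ρ := ρ) (Finset.mem_filter.1 hαβ).2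
  set M := 3 * Fintype.card (T ⊕ T') + 2 * numCycles (Equiv.Perm.sumCongr π ρ) with hM
  have h1 := (tendsto_monomial hs (m := M - 2) (Nat.le_sub_of_add_le hdeg)).isBigO_one ℝ
  have h2 := h1.mul (Asymptotics.isBigO_refl (fun d : ℕ => 1 / (d : ℝ) ^ 2) atTop)
  simp only [one_mul] at h2
  refine h2.congr' ?_ EventuallyEq.rfl
  filter_upwards [eventually_gt_atTop 0] with d hd
  have hd' : (d : ℝ) ≠ 0 := by positivity
  have : (d : ℝ) ^ M = (d : ℝ) ^ (M - 2) * (d : ℝ) ^ 2 := by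
    rw [← pow_add]
    congr 1
    omega
  rw [this, div_mul_div_comm, mul_one]

theorem numCycles_finRotate (q : ℕ) : numCycles (finRotate (q + 1)) = 1 := by
  have h := numCycles_formPerm_mul (0 : Fin (q + 1)) ((List.finRange q).map Fin.succ) 1
    (by rw [← List.finRange_succ]; exact List.nodup_finRange _) (fun _ _ => rfl)
  rw [← List.finRange_succ, formPerm_finRange, mul_one, numCycles_one] at h
  simp at h
  omega

end Asymptotics

/-! ### From moment convergence to weak convergence -/

section Moments

open Polynomial

theorem integrable_eval {ν : Measure ℝ} (hν : ∀ p : ℕ, Integrable (fun x => x ^ p) ν) (q : ℝ[X]) :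
    Integrable (fun x => q.eval x) ν := by
  simp only [eval_eq_sum_range]
  exact integrable_finsetSum _ fun i _ => (hν i).const_mul _

theorem integral_eval {ν : Measure ℝ} (hν : ∀ p : ℕ, Integrable (fun x => x ^ p) ν) (q : ℝ[X]) :
    ∫ x, q.eval x ∂ν = ∑ i ∈ Finset.range (q.natDegree + 1), q.coeff i * ∫ x, x ^ i ∂ν := by
  simp only [eval_eq_sum_range]
  rw [integral_finsetSum _ fun i _ => (hν i).const_mul _]
  simp only [integral_const_mul]

theorem integrable_pow_of_ae_abs_le {μ : Measure ℝ} [IsFiniteMeasure μ] {K : ℝ}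
    (hK : ∀ᵐ x ∂μ, |x| ≤ K) (p : ℕ) : Integrable (fun x => x ^ p) μ := by
  refine Integrable.of_bound (by fun_prop) (K ^ p) ?_
  filter_upwards [hK] with x hx
  rw [norm_pow]
  exact pow_le_pow_left₀ (norm_nonneg _) hx p

/-- The error outside [-L, L] grows at most like |x|^deg q, which there is dominated by a large even
power of x/L. The majorant is a polynomial, so its integrals are controlled by moments. -/
theorem abs_sub_eval_le {L ε : ℝ} (hL : 1 ≤ L) (hε : 0 ≤ ε) (f : ℝ →ᵇ ℝ) (q : ℝ[X])
    (hq : ∀ x ∈ Set.Icc (-L) L, |q.eval x - f x| < ε) {m : ℕ} (hm : q.natDegree ≤ 2 * m) (x : ℝ) :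
    |f x - q.eval x| ≤ ε + (‖f‖ + ∑ i ∈ Finset.range (q.natDegree + 1), |q.coeff i|) *
      L ^ q.natDegree / L ^ (2 * m) * x ^ (2 * m) := by
  set B := ‖f‖ + ∑ i ∈ Finset.range (q.natDegree + 1), |q.coeff i| with hB
  have hB0 : 0 ≤ B := by positivity
  have hL0 : 0 < L := by linarith
  have hx2 : x ^ (2 * m) = |x| ^ (2 * m) := by rw [pow_mul, pow_mul, sq_abs]
  by_cases hx : |x| ≤ L
  · have h1 := hq x (abs_le.1 hx)
    rw [abs_sub_comm] at h1
    have : 0 ≤ B * L ^ q.natDegree / L ^ (2 * m) * x ^ (2 * m) := by rw [hx2]; positivity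
    linarith
  · push Not at hx
    have hx1 : 1 ≤ |x| := hL.trans hx.le
    have h1 : |f x| ≤ ‖f‖ * |x| ^ q.natDegree :=
      (f.norm_coe_le_norm x).trans (le_mul_of_one_le_right (norm_nonneg _) (one_le_pow₀ hx1))
    have h2 : |q.eval x| ≤ (∑ i ∈ Finset.range (q.natDegree + 1), |q.coeff i|) *
        |x| ^ q.natDegree := by
      rw [eval_eq_sum_range, Finset.sum_mul]
      refine (Finset.abs_sum_le_sum_abs _ _).trans (Finset.sum_le_sum fun i hi => ?_)
      rw [abs_mul, abs_pow]
      exact mul_le_mul_of_nonneg_left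
        (pow_le_pow_right₀ hx1 (Nat.lt_succ_iff.1 (Finset.mem_range.1 hi))) (abs_nonneg _)
    have h3 : |x| ^ q.natDegree ≤ L ^ q.natDegree / L ^ (2 * m) * |x| ^ (2 * m) := by
      obtain ⟨k, hk⟩ := Nat.exists_eq_add_of_le hm
      rw [hk, pow_add, pow_add]
      have h4 : L ^ k ≤ |x| ^ k := pow_le_pow_left₀ hL0.le hx.le k
      have h5 : L ^ q.natDegree / (L ^ q.natDegree * L ^ k) * (|x| ^ q.natDegree * |x| ^ k) =
          |x| ^ q.natDegree * (|x| ^ k / L ^ k) := by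
        field_simp
      rw [h5]
      exact le_mul_of_one_le_right (by positivity) ((one_le_div (by positivity)).2 h4)
    calc |f x - q.eval x| ≤ |f x| + |q.eval x| := abs_sub _ _
      _ ≤ B * |x| ^ q.natDegree := by rw [hB, add_mul]; exact add_le_add h1 h2
      _ ≤ B * (L ^ q.natDegree / L ^ (2 * m) * |x| ^ (2 * m)) := by gcongr
      _ = B * L ^ q.natDegree / L ^ (2 * m) * x ^ (2 * m) := by rw [hx2]; ring
      _ ≤ _ := by linarith

/-- Convergence of all moments to those of a compactly supported probability measure implies weak
convergence. -/
theorem tendsto_integral_of_tendsto_moments {ν : ℕ → Measure ℝ} {μ : Measure ℝ}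
    [IsProbabilityMeasure μ] {K : ℝ} (hK : ∀ᵐ x ∂μ, |x| ≤ K)
    (hprob : ∀ᶠ n in atTop, IsProbabilityMeasure (ν n))
    (hint : ∀ n, ∀ p : ℕ, Integrable (fun x => x ^ p) (ν n))
    (hmom : ∀ p : ℕ, Tendsto (fun n => ∫ x, x ^ p ∂(ν n)) atTop (𝓝 (∫ x, x ^ p ∂μ)))
    (f : ℝ →ᵇ ℝ) :
    Tendsto (fun n => ∫ x, f x ∂(ν n)) atTop (𝓝 (∫ x, f x ∂μ)) := by
  have hμ := integrable_pow_of_ae_abs_le hK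
  have hpoly : ∀ q : ℝ[X],
      Tendsto (fun n => ∫ x, q.eval x ∂(ν n)) atTop (𝓝 (∫ x, q.eval x ∂μ)) := by
    intro q
    simp only [integral_eval (hint _), integral_eval hμ]
    exact tendsto_finsetSum _ fun i _ => (hmom i).const_mul _
  rw [Metric.tendsto_atTop']
  intro η hη
  -- The budget is 5ε/2 for replacing `f` by `q` under `ν n`, ε/2 for the convergence of the
  -- integrals of `q`, and 2ε for going back to `f` under `μ`.
  obtain ⟨ε, hε, hεη⟩ : ∃ ε : ℝ, 0 < ε ∧ 5 * ε < η := ⟨η / 6, by positivity, by linarith⟩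
  set K' := max K 1 with hK'
  have hK'1 : 1 ≤ K' := le_max_right _ _
  -- Taking twice the support bound makes (x/L)^(2m) at most 4^(-m) on the support of `μ`.
  set L := 2 * K' with hL
  have hL1 : 1 ≤ L := by linarith
  obtain ⟨q, hq⟩ := exists_polynomial_near_of_continuousOn (-L) L f f.continuous.continuousOn ε hε
  set B := (‖f‖ + ∑ i ∈ Finset.range (q.natDegree + 1), |q.coeff i|) * L ^ q.natDegree with hB
  have hB0 : 0 ≤ B := by positivity
  obtain ⟨m, hmq, hmε⟩ : ∃ m : ℕ, q.natDegree ≤ 2 * m ∧ B * ((1 / 2 : ℝ) ^ 2) ^ m ≤ ε := by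
    have h1 : Tendsto (fun m : ℕ => B * ((1 / 2 : ℝ) ^ 2) ^ m) atTop (𝓝 (B * 0)) :=
      (tendsto_pow_atTop_nhds_zero_of_lt_one (by norm_num) (by norm_num)).const_mul B
    rw [mul_zero] at h1
    obtain ⟨m, h2, h3⟩ := ((h1.eventually_le_const hε).and
      (eventually_ge_atTop q.natDegree)).exists
    exact ⟨m, by omega, h2⟩
  set g : ℝ[X] := C ε + C (B / L ^ (2 * m)) * X ^ (2 * m) with hg
  have hfg : ∀ x, |f x - q.eval x| ≤ g.eval x := by
    intro x
    have := abs_sub_eval_le hL1 hε.le f q hq hmq x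
    simpa [hg, hB] using this
  have hgμ : ∫ x, g.eval x ∂μ ≤ 2 * ε := by
    have h1 : ∀ᵐ x ∂μ, g.eval x ≤ 2 * ε := by
      filter_upwards [hK] with x hx
      have h2 : x ^ (2 * m) ≤ K' ^ (2 * m) := by
        rw [pow_mul, ← sq_abs, ← pow_mul]
        exact pow_le_pow_left₀ (abs_nonneg _) (hx.trans (le_max_left _ _)) _
      have h3 : B / L ^ (2 * m) * x ^ (2 * m) ≤ B / L ^ (2 * m) * K' ^ (2 * m) :=
        mul_le_mul_of_nonneg_left h2 (by positivity)
      have h4 : B / L ^ (2 * m) * K' ^ (2 * m) = B * ((1 / 2 : ℝ) ^ 2) ^ m := by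
        rw [hL, mul_pow, ← pow_mul, one_div, inv_pow]
        field_simp
      simp only [hg, eval_add, eval_C, eval_mul, eval_pow, eval_X]
      linarith
    calc ∫ x, g.eval x ∂μ ≤ ∫ _, 2 * ε ∂μ :=
          integral_mono_ae (integrable_eval hμ g) (integrable_const _) h1
      _ = 2 * ε := by simp
  have hclose : ∀ (ρ : Measure ℝ), IsProbabilityMeasure ρ →
      (∀ p : ℕ, Integrable (fun x => x ^ p) ρ) →
      |∫ x, f x ∂ρ - ∫ x, q.eval x ∂ρ| ≤ ∫ x, g.eval x ∂ρ := by
    intro ρ hρ hρi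
    rw [← integral_sub (f.integrable ρ) (integrable_eval hρi q)]
    exact (abs_integral_le_integral_abs).trans (integral_mono_ae
      ((f.integrable ρ).sub (integrable_eval hρi q)).abs (integrable_eval hρi g)
      (ae_of_all _ hfg))
  have h1 := (hpoly g).eventually_lt_const (show ∫ x, g.eval x ∂μ < 2 * ε + ε / 2 by linarith)
  have h2 := (Metric.tendsto_nhds.1 (hpoly q)) (ε / 2) (by positivity)
  obtain ⟨N, hN⟩ := eventually_atTop.1 (h1.and (h2.and hprob))
  refine ⟨N, fun n hn => ?_⟩
  obtain ⟨h3, h4, h5⟩ := hN n hn.le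
  have h6 := hclose (ν n) h5 (hint n)
  have h7 := hclose μ inferInstance hμ
  rw [Real.dist_eq] at h4 ⊢
  rw [abs_le] at h6 h7
  rw [abs_lt] at h4 ⊢
  constructor <;> linarith [h6.1, h6.2, h7.1, h7.2, h4.1, h4.2]

end Moments

/-! ### Hermitian matrices and their spectral measures -/

section Hermitian

theorem isHermitian_wishartMap {n : Type*} (s : ℕ) (g : n × Fin s → ℂ) :
    (wishartMap s g).IsHermitian :=
  Matrix.isHermitian_mul_conjTranspose_self _

/-- Only the law of `W` is given, so the symmetry of `wishartMap` transfers almost surely, entry by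
entry. -/
theorem ae_isHermitian {Ω : Type*} [MeasurableSpace Ω] {P : Measure Ω} {n : Type*} [Fintype n]
    {s : ℕ} {W : Ω → Matrix n n ℂ} (hW : HasLaw W (wishart n s) P) :
    ∀ᵐ ω ∂P, (W ω).IsHermitian := by
  have h : ∀ i j, ∀ᵐ ω ∂P, star (W ω j i) = W ω i j := by
    intro i j
    have hentry : ∀ i j : n, Measurable fun M : Matrix n n ℂ => M i j := fun i j =>
      (measurable_pi_apply j).comp (measurable_pi_apply i)
    have hset : MeasurableSet {M : Matrix n n ℂ | star (M j i) = M i j} :=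
      measurableSet_eq_fun (f := fun M : Matrix n n ℂ => star (M j i))
        (Complex.continuous_conj.measurable.comp (hentry j i)) (hentry i j)
    have h1 : ∀ᵐ M ∂(wishart n s), star (M j i) = M i j :=
      (ae_map_iff (measurable_wishartMap s).aemeasurable hset).2
        (ae_of_all _ fun g => (isHermitian_wishartMap s g).apply i j)
    rw [← hW.map_eq] at h1
    exact ae_of_ae_map hW.aemeasurable h1
  filter_upwards [ae_all_iff.2 fun i => ae_all_iff.2 (h i)] with ω hω
  exact Matrix.IsHermitian.ext hω

theorem isHermitian_unnormalizedSwap {d : ℕ}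
    {W₁ W₂ : Matrix (Fin d × Fin d) (Fin d × Fin d) ℂ} (h₁ : W₁.IsHermitian)
    (h₂ : W₂.IsHermitian) : (unnormalizedSwap W₁ W₂).IsHermitian := by
  refine Matrix.IsHermitian.ext fun k l => ?_
  simp only [unnormalizedSwap, Matrix.of_apply, star_sum, star_mul', h₁.apply, h₂.apply]
  exact (Equiv.prodComm (Fin d) (Fin d)).sum_comp fun i : Fin d × Fin d =>
    W₁ (i.1, k.1) (i.2, l.1) * W₂ (i.1, k.2) (i.2, l.2)

theorem ofReal_re_cyclicTrace {n : Type*} [Fintype n] [DecidableEq n] {A : Matrix n n ℂ}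
    (hA : A.IsHermitian) (q : ℕ) :
    (((cyclicTrace (finRotate (q + 1)) A).re : ℝ) : ℂ) = cyclicTrace (finRotate (q + 1)) A := by
  rw [← trace_pow_succ, ← Complex.conj_eq_iff_re]
  have h := (hA.pow (q + 1)).eq
  have h1 : star (A ^ (q + 1)).trace = (A ^ (q + 1)).trace := by
    rw [← Matrix.trace_conjTranspose, h]
  exact h1

/-- The trace of a power of a Hermitian matrix in terms of its eigenvalues. -/
theorem trace_pow_eq_sum_eigenvalues {n : Type*} [Fintype n] [DecidableEq n] {A : Matrix n n ℂ}
    (hA : A.IsHermitian) (p : ℕ) :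
    (A ^ p).trace = ((∑ i, hA.eigenvalues i ^ p : ℝ) : ℂ) := by
  conv_lhs => rw [hA.spectral_theorem, ← map_pow, Unitary.conjStarAlgAut_apply,
    Matrix.trace_mul_comm, ← mul_assoc]
  simp [Matrix.diagonal_pow, Matrix.trace_diagonal]

theorem integrable_empiricalSpectralDistribution {n : Type*} [Fintype n] [DecidableEq n]
    (A : Matrix n n ℂ) (f : ℝ → ℝ) :
    Integrable f (empiricalSpectralDistribution A) := by
  unfold empiricalSpectralDistribution
  split_ifs with h
  · rcases isEmpty_or_nonempty n with _ | _
    · simp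
    refine Integrable.smul_measure ?_ (by simp)
    rw [integrable_finsetSum_measure]
    exact fun i _ => integrable_dirac (by simp)
  · exact integrable_zero_measure

theorem isProbabilityMeasure_empiricalSpectralDistribution {n : Type*} [Fintype n]
    [DecidableEq n] [Nonempty n] {A : Matrix n n ℂ} (hA : A.IsHermitian) :
    IsProbabilityMeasure (empiricalSpectralDistribution A) := by
  constructor
  rw [empiricalSpectralDistribution, dif_pos hA]
  simp only [Measure.smul_apply, Measure.finsetSum_apply, measure_univ, Finset.sum_const,
    Finset.card_univ, nsmul_eq_mul, mul_one, smul_eq_mul]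
  exact ENNReal.inv_mul_cancel (by simp) (by simp)

theorem integral_pow_empiricalSpectralDistribution {n : Type*} [Fintype n] [DecidableEq n]
    {A : Matrix n n ℂ} (hA : A.IsHermitian) (p : ℕ) :
    ∫ x, x ^ p ∂(empiricalSpectralDistribution A) =
      (A ^ p).trace.re / (Fintype.card n : ℝ) := by
  rw [empiricalSpectralDistribution, dif_pos hA, integral_smul_measure,
    integral_finsetSum_measure fun i _ => integrable_dirac (by simp),
    trace_pow_eq_sum_eigenvalues hA, Complex.ofReal_re]
  simp only [integral_dirac, smul_eq_mul, ENNReal.toReal_inv, ENNReal.toReal_natCast]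
  rw [div_eq_inv_mul]

end Hermitian

/-! ### Almost sure convergence of the traces -/

section AlmostSure

/-- The sum of the squares has finite expectation, hence is almost surely finite, so its terms tend
to 0. Independence plays no role. -/
theorem ae_tendsto_zero_of_integral_sq_isBigO {Ω : Type*} [MeasurableSpace Ω] {P : Measure Ω}
    {f : ℕ → Ω → ℝ} (hf : ∀ n, AEMeasurable (f n) P)
    (hint : ∀ n, Integrable (fun ω => f n ω ^ 2) P)
    (hO : (fun n => ∫ ω, f n ω ^ 2 ∂P) =O[atTop] fun n : ℕ => 1 / (n : ℝ) ^ 2) :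
    ∀ᵐ ω ∂P, Tendsto (fun n => f n ω) atTop (𝓝 0) := by
  have hsum : Summable fun n => ∫ ω, f n ω ^ 2 ∂P :=
    summable_of_isBigO_nat (Real.summable_one_div_nat_pow.2 (by norm_num)) hO
  have hmeas : ∀ n, AEMeasurable (fun ω => ENNReal.ofReal (f n ω ^ 2)) P := fun n =>
    ((hf n).pow_const 2).ennreal_ofReal
  have h1 : ∫⁻ ω, ∑' n, ENNReal.ofReal (f n ω ^ 2) ∂P ≠ ⊤ := by
    rw [lintegral_tsum hmeas]
    have : ∀ n, ∫⁻ ω, ENNReal.ofReal (f n ω ^ 2) ∂P = ENNReal.ofReal (∫ ω, f n ω ^ 2 ∂P) :=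
      fun n => (ofReal_integral_eq_lintegral_ofReal (hint n)
        (ae_of_all _ fun ω => sq_nonneg _)).symm
    simp only [this]
    exact hsum.tsum_ofReal_ne_top
  filter_upwards [ae_lt_top' (AEMeasurable.tsum hmeas) h1] with ω hω
  have h2 := ENNReal.tendsto_atTop_zero_of_tsum_ne_top hω.ne
  have h3 : Tendsto (fun n => f n ω ^ 2) atTop (𝓝 0) := by
    have := (ENNReal.tendsto_toReal ENNReal.zero_ne_top).comp h2
    refine (this.congr fun n => ?_)
    simp [ENNReal.toReal_ofReal (sq_nonneg _)]
  have h4 := h3.sqrt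
  simp only [Real.sqrt_sq_eq_abs, Real.sqrt_zero] at h4
  exact (tendsto_zero_iff_abs_tendsto_zero _).2 h4

variable {Ω : Type*} [MeasurableSpace Ω] {P : Measure Ω} [IsProbabilityMeasure P]

theorem integral_sq_sub_swapMoment {d s q : ℕ}
    {W₁ W₂ : Ω → Matrix (Fin d × Fin d) (Fin d × Fin d) ℂ}
    (hW₁ : HasLaw W₁ (wishart (Fin d × Fin d) s) P)
    (hW₂ : HasLaw W₂ (wishart (Fin d × Fin d) s) P) (hindep : IndepFun W₁ W₂ P) (D : ℝ) :
    (AEMeasurable (fun ω => ((cyclicTrace (finRotate (q + 1))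
        (unnormalizedSwap (W₁ ω) (W₂ ω))).re - swapMoment d s (finRotate (q + 1))) / D) P) ∧
    Integrable (fun ω => (((cyclicTrace (finRotate (q + 1))
        (unnormalizedSwap (W₁ ω) (W₂ ω))).re - swapMoment d s (finRotate (q + 1))) / D) ^ 2) P ∧
    ∫ ω, (((cyclicTrace (finRotate (q + 1))
        (unnormalizedSwap (W₁ ω) (W₂ ω))).re - swapMoment d s (finRotate (q + 1))) / D) ^ 2 ∂P =
      (swapMoment d s (Equiv.Perm.sumCongr (finRotate (q + 1)) (finRotate (q + 1))) -
        swapMoment d s (finRotate (q + 1)) * swapMoment d s (finRotate (q + 1))) / D ^ 2 := by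
  set m := swapMoment d s (finRotate (q + 1)) with hm
  set Y : Ω → ℝ := fun ω => (cyclicTrace (finRotate (q + 1))
    (unnormalizedSwap (W₁ ω) (W₂ ω))).re with hY
  have hI := integrable_cyclicTrace hW₁ hW₂ hindep (finRotate (q + 1))
  have hI2 := integrable_cyclicTrace hW₁ hW₂ hindep
    (Equiv.Perm.sumCongr (finRotate (q + 1)) (finRotate (q + 1)))
  have hYI : Integrable Y P := hI.re
  -- The trace is almost surely real, so squaring its real part agrees with doubling the
  -- permutation.
  have hsq : (fun ω => Y ω ^ 2) =ᵐ[P] fun ω => (cyclicTrace (Equiv.Perm.sumCongr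
      (finRotate (q + 1)) (finRotate (q + 1))) (unnormalizedSwap (W₁ ω) (W₂ ω))).re := by
    filter_upwards [ae_isHermitian hW₁, ae_isHermitian hW₂] with ω h1 h2
    rw [cyclicTrace_sumCongr, ← ofReal_re_cyclicTrace (isHermitian_unnormalizedSwap h1 h2),
      ← Complex.ofReal_mul, Complex.ofReal_re, sq]
  have hY2I : Integrable (fun ω => Y ω ^ 2) P := hI2.re.congr hsq.symm
  have hre : ∀ {f : Ω → ℂ}, Integrable f P → ∫ ω, (f ω).re ∂P = (∫ ω, f ω ∂P).re :=
    fun {f} hf => integral_re hf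
  have hEY : ∫ ω, Y ω ∂P = m := by
    rw [hY, hre hI, integral_cyclicTrace hW₁ hW₂ hindep, Complex.ofReal_re]
  have hEY2 : ∫ ω, Y ω ^ 2 ∂P = swapMoment d s
      (Equiv.Perm.sumCongr (finRotate (q + 1)) (finRotate (q + 1))) := by
    rw [integral_congr_ae hsq, hre hI2, integral_cyclicTrace hW₁ hW₂ hindep, Complex.ofReal_re]
  have hexp : ∀ ω, ((Y ω - m) / D) ^ 2 = (Y ω ^ 2 - 2 * m * Y ω + m ^ 2) / D ^ 2 := by
    intro ω
    rw [div_pow]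
    congr 1
    ring
  have hint : Integrable (fun ω => Y ω ^ 2 - 2 * m * Y ω + m ^ 2) P :=
    (hY2I.sub (hYI.const_mul _)).add (integrable_const _)
  refine ⟨(hYI.aemeasurable.sub_const _).div_const _, ?_, ?_⟩
  · change Integrable (fun ω => ((Y ω - m) / D) ^ 2) P
    simp only [hexp]
    exact hint.div_const _
  · change ∫ ω, ((Y ω - m) / D) ^ 2 ∂P = _
    simp only [hexp]
    have hsub : Integrable (fun ω => Y ω ^ 2 - 2 * m * Y ω) P := hY2I.sub (hYI.const_mul _)
    rw [integral_div, integral_add hsub (integrable_const _),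
      integral_sub hY2I (hYI.const_mul _), integral_const_mul, hEY, hEY2]
    simp
    ring

theorem ae_tendsto_cyclicTrace {c : ℝ} (hc : 0 < c) {s : ℕ → ℕ}
    (hs : Tendsto (fun d : ℕ => (s d : ℝ) / (d : ℝ)) atTop (𝓝 c))
    {W₁ W₂ : (d : ℕ) → Ω → Matrix (Fin d × Fin d) (Fin d × Fin d) ℂ}
    (hW₁ : ∀ d, HasLaw (W₁ d) (wishart (Fin d × Fin d) (s d)) P)
    (hW₂ : ∀ d, HasLaw (W₂ d) (wishart (Fin d × Fin d) (s d)) P)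
    (hindep : ∀ d, IndepFun (W₁ d) (W₂ d) P) (q : ℕ) :
    ∀ᵐ ω ∂P, Tendsto (fun d : ℕ => (cyclicTrace (finRotate (q + 1))
      (unnormalizedSwap (W₁ d ω) (W₂ d ω))).re / (d : ℝ) ^ (3 * (q + 1) + 2)) atTop
      (𝓝 (mpMoment (c ^ 2) (q + 1))) := by
  have hmean := tendsto_swapMoment hs (finRotate (q + 1))
  rw [geodesicSum_finRotate (by positivity), Fintype.card_fin, numCycles_finRotate,
    mul_one] at hmean
  have hvar := swapMoment_covariance_isBigO hs (finRotate (q + 1)) (finRotate (q + 1))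
  rw [Fintype.card_sum, Fintype.card_fin, numCycles_sumCongr, numCycles_finRotate] at hvar
  have hprop := fun d => integral_sq_sub_swapMoment (q := q) (hW₁ d) (hW₂ d) (hindep d)
    ((d : ℝ) ^ (3 * (q + 1) + 2))
  have h := ae_tendsto_zero_of_integral_sq_isBigO (fun d => (hprop d).1)
    (fun d => (hprop d).2.1) (by
      refine hvar.congr_left fun d => ?_
      rw [(hprop d).2.2, ← pow_mul]
      congr 2
      ring)
  filter_upwards [h] with ω hω
  have := hω.add hmean
  rw [zero_add] at this
  refine this.congr fun d => ?_
  rw [← add_div, sub_add_cancel]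

end AlmostSure

/-! ### Centering, rescaling and conclusion -/

section Main

theorem rescaledSwap_eq {d s : ℕ} (hd : d ≠ 0) (hs : s ≠ 0)
    (W₁ W₂ : Matrix (Fin d × Fin d) (Fin d × Fin d) ℂ) :
    rescaledSwap s W₁ W₂ = (((d : ℝ) ^ 2 * s)⁻¹ : ℝ) • unnormalizedSwap W₁ W₂ +
      (-((s : ℝ) / d) : ℝ) • 1 := by
  have hd' : (d : ℂ) ≠ 0 := Nat.cast_ne_zero.2 hd
  have hs' : (s : ℂ) ≠ 0 := Nat.cast_ne_zero.2 hs
  ext k l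
  simp only [rescaledSwap, swap_eq, Matrix.smul_apply, Matrix.sub_apply, Matrix.add_apply,
    smul_eq_mul, Complex.real_smul]
  push_cast
  field_simp
  ring

theorem isHermitian_rescaledSwap {d s : ℕ} (hd : d ≠ 0) (hs : s ≠ 0)
    {W₁ W₂ : Matrix (Fin d × Fin d) (Fin d × Fin d) ℂ} (h₁ : W₁.IsHermitian)
    (h₂ : W₂.IsHermitian) : (rescaledSwap s W₁ W₂).IsHermitian := by
  rw [rescaledSwap_eq hd hs]
  have h := (isHermitian_unnormalizedSwap h₁ h₂).eq
  rw [Matrix.IsHermitian, Matrix.conjTranspose_add, Matrix.conjTranspose_smul,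
    Matrix.conjTranspose_smul, h, Matrix.conjTranspose_one, star_trivial, star_trivial]

theorem trace_rescaledSwap_pow {d s : ℕ} (hd : d ≠ 0) (hs : s ≠ 0)
    (W₁ W₂ : Matrix (Fin d × Fin d) (Fin d × Fin d) ℂ) (p : ℕ) :
    (rescaledSwap s W₁ W₂ ^ p).trace.re = ∑ k ∈ Finset.range (p + 1),
      (((d : ℝ) ^ 2 * s)⁻¹) ^ k * (-((s : ℝ) / d)) ^ (p - k) * (p.choose k) *
        ((unnormalizedSwap W₁ W₂) ^ k).trace.re := by
  rw [rescaledSwap_eq hd hs, Commute.add_pow ((Commute.one_right _).smul_right _),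
    Matrix.trace_sum, Complex.re_sum]
  refine Finset.sum_congr rfl fun k _ => ?_
  have : ((((d : ℝ) ^ 2 * s)⁻¹ : ℝ) • unnormalizedSwap W₁ W₂) ^ k *
      ((-((s : ℝ) / d) : ℝ) • (1 : Matrix (Fin d × Fin d) (Fin d × Fin d) ℂ)) ^ (p - k) *
        ((p.choose k : ℕ) : Matrix (Fin d × Fin d) (Fin d × Fin d) ℂ) =
      (((((d : ℝ) ^ 2 * s)⁻¹) ^ k * (-((s : ℝ) / d)) ^ (p - k) * (p.choose k) : ℝ)) •
        (unnormalizedSwap W₁ W₂) ^ k := by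
    rw [smul_pow, smul_pow, one_pow, mul_smul_comm, mul_one, ← nsmul_eq_mul',
      ← Nat.cast_smul_eq_nsmul ℝ, smul_smul, smul_smul]
    congr 1
    ring
  rw [this, Matrix.trace_smul, Complex.smul_re, smul_eq_mul]

theorem tendsto_moment_of_tendsto_cyclicTrace {c : ℝ} (hc : 0 < c) {s : ℕ → ℕ}
    (hs : Tendsto (fun d : ℕ => (s d : ℝ) / (d : ℝ)) atTop (𝓝 c))
    (W₁ W₂ : (d : ℕ) → Matrix (Fin d × Fin d) (Fin d × Fin d) ℂ)
    (hW₁ : ∀ d, (W₁ d).IsHermitian) (hW₂ : ∀ d, (W₂ d).IsHermitian)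
    (h : ∀ q : ℕ, Tendsto (fun d : ℕ => (cyclicTrace (finRotate (q + 1))
      (unnormalizedSwap (W₁ d) (W₂ d))).re / (d : ℝ) ^ (3 * (q + 1) + 2)) atTop
      (𝓝 (mpMoment (c ^ 2) (q + 1)))) (p : ℕ) :
    Tendsto (fun d : ℕ => ∫ x, x ^ p ∂(empiricalSpectralDistribution
      (rescaledSwap (s d) (W₁ d) (W₂ d)))) atTop (𝓝 (centeredMoment c p)) := by
  -- Eventually `s d / d` is positive; as division by 0 gives 0, this excludes `d = 0` as well as `s
  -- d = 0`.
  have hpos : ∀ᶠ d in atTop, d ≠ 0 ∧ s d ≠ 0 := by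
    filter_upwards [hs.eventually_const_lt hc] with d hd
    constructor
    · rintro rfl
      simp at hd
    · intro h0
      simp [h0] at hd
  have htr : ∀ k : ℕ, Tendsto (fun d : ℕ => ((unnormalizedSwap (W₁ d) (W₂ d)) ^ k).trace.re /
      (d : ℝ) ^ (3 * k + 2)) atTop (𝓝 (mpMoment (c ^ 2) k)) := by
    intro k
    cases k with
    | zero =>
      rw [mpMoment_zero]
      refine tendsto_const_nhds.congr' ?_
      filter_upwards [hpos] with d hd
      have : (d : ℝ) ≠ 0 := Nat.cast_ne_zero.2 hd.1
      simp [Matrix.trace_one]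
      field_simp
    | succ q =>
      simp only [trace_pow_succ]
      exact h q
  -- Of the exponent 3k + 2, the 2 is the matrix size d², and (d²s)^k equals d^(3k) (s/d)^k, so the
  -- binomial expansion is written in convergent quantities.
  have hlim : Tendsto (fun d : ℕ => ∑ k ∈ Finset.range (p + 1),
      ((unnormalizedSwap (W₁ d) (W₂ d)) ^ k).trace.re / (d : ℝ) ^ (3 * k + 2) /
        ((s d : ℝ) / d) ^ k * (-((s d : ℝ) / d)) ^ (p - k) * (p.choose k)) atTop
      (𝓝 (centeredMoment c p)) :=
    tendsto_finsetSum _ fun k _ => (((htr k).div (hs.pow k) (by positivity)).mul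
      (hs.neg.pow (p - k))).mul_const _
  refine hlim.congr' ?_
  filter_upwards [hpos] with d hd
  have hd' : (d : ℝ) ≠ 0 := Nat.cast_ne_zero.2 hd.1
  have hs' : (s d : ℝ) ≠ 0 := Nat.cast_ne_zero.2 hd.2
  rw [integral_pow_empiricalSpectralDistribution
    (isHermitian_rescaledSwap hd.1 hd.2 (hW₁ d) (hW₂ d)), trace_rescaledSwap_pow hd.1 hd.2,
    Finset.sum_div]
  refine Finset.sum_congr rfl fun k _ => ?_
  rw [Fintype.card_prod, Fintype.card_fin, pow_add, mul_comm 3 k, pow_mul', inv_pow, mul_pow,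
    div_pow]
  push_cast
  field_simp
  ring

end Main

end WishartMoments

/-- For every `d`, let `W₁ d`, `W₂ d` be independent complex Wishart matrices of parameters
`(d², s d)` (no assumption is made on the joint law for different `d`). If `s d / d → c > 0`, then
almost surely the empirical spectral distribution of `Z` converges, weakly and in moments, to the
centered Marchenko-Pastur distribution of parameter `c²` rescaled by `c`. -/
theorem corollary3p5 {Ω : Type*} [MeasurableSpace Ω] (P : Measure Ω) [IsProbabilityMeasure P]
    (c : ℝ) (hc : 0 < c) (s : ℕ → ℕ)
    (hs : Tendsto (fun d : ℕ => (s d : ℝ) / (d : ℝ)) atTop (𝓝 c))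
    (W₁ W₂ : (d : ℕ) → Ω → Matrix (Fin d × Fin d) (Fin d × Fin d) ℂ)
    (hW₁ : ∀ d, HasLaw (W₁ d) (EntanglementSwapping.wishart (Fin d × Fin d) (s d)) P)
    (hW₂ : ∀ d, HasLaw (W₂ d) (EntanglementSwapping.wishart (Fin d × Fin d) (s d)) P)
    (hindep : ∀ d, IndepFun (W₁ d) (W₂ d) P) :
    ∀ᵐ ω ∂P,
      (∀ f : ℝ →ᵇ ℝ,
        Tendsto
          (fun d : ℕ => ∫ x, f x ∂(EntanglementSwapping.empiricalSpectralDistribution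
            (EntanglementSwapping.rescaledSwap (s d) (W₁ d ω) (W₂ d ω))))
          atTop (𝓝 (∫ x, f x ∂(EntanglementSwapping.centeredRescaledMarchenkoPastur c)))) ∧
      (∀ p : ℕ,
        Tendsto
          (fun d : ℕ => ∫ x, x ^ p ∂(EntanglementSwapping.empiricalSpectralDistribution
            (EntanglementSwapping.rescaledSwap (s d) (W₁ d ω) (W₂ d ω))))
          atTop (𝓝 (∫ x, x ^ p ∂(EntanglementSwapping.centeredRescaledMarchenkoPastur c)))) := by
  have hpos : ∀ᶠ d in atTop, d ≠ 0 ∧ s d ≠ 0 := by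
    filter_upwards [hs.eventually_const_lt hc] with d hd
    constructor
    · rintro rfl
      simp at hd
    · intro h0
      simp [h0] at hd
  have hprob := WishartMoments.isProbabilityMeasure_centeredRescaled hc
  obtain ⟨K, hK⟩ := WishartMoments.ae_centeredRescaled hc
  filter_upwards [ae_all_iff.2 fun q => WishartMoments.ae_tendsto_cyclicTrace hc hs hW₁ hW₂ hindep q,
    ae_all_iff.2 fun d => WishartMoments.ae_isHermitian (hW₁ d),
    ae_all_iff.2 fun d => WishartMoments.ae_isHermitian (hW₂ d)] with ω h h1 h2
  have hmom := fun p => WishartMoments.tendsto_moment_of_tendsto_cyclicTrace hc hs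
    (fun d => W₁ d ω) (fun d => W₂ d ω) h1 h2 h p
  simp only [← WishartMoments.integral_pow_centeredRescaled hc] at hmom
  refine ⟨fun f => ?_, hmom⟩
  refine WishartMoments.tendsto_integral_of_tendsto_moments hK ?_ ?_ hmom f
  · filter_upwards [hpos] with d hd
    have : Nonempty (Fin d) := ⟨⟨0, Nat.pos_of_ne_zero hd.1⟩⟩
    exact WishartMoments.isProbabilityMeasure_empiricalSpectralDistribution
      (WishartMoments.isHermitian_rescaledSwap hd.1 hd.2 (h1 d) (h2 d))
  · intro d p
    exact WishartMoments.integrable_empiricalSpectralDistribution _ _
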